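/- Let $(W,S)$ be a Coxeter system with $S$ finite and $W$ infinite. For $T\subseteq S$ let $W_T$ be the subgroup generated by $T$. The nerve of $(W,S)$ is the simplicial complex of all nonempty $T\subseteq S$ with $W_T$ finite. Assume that $(W,S)$ is of type PM: for some $d\ge 0$ its nerve is purely $d$-dimensional; every $(d-1)$-simplex lies in exactly two maximal simplices (for $d=0$ this is required of the empty simplex, so that the nerve consists of two points); the maximal simplices can be oriented so that their sum is a cycle; and any two maximal simplices can be joined by a finite sequence of maximal simplices in which consecutive ones share a face of dimension $d-1$. Let $\mathcal C$ be a (nonempty) building of type $(W,S)$, that is, a set of chambers with an equivalence relation for each $s\in S$, all of whose classes have at least two elements, and with a map $d_W:\mathcal C\times\mathcal C\to W$ such that, for every reduced word $\omega$ representing $w\in W$, two chambers $c,c'$ are joined by a gallery of type $\omega$ if and only if $d_W(c,c')=w$. Assume that $\mathcal C$ is regular with thickness vector $\mathbf q+1$, where $\mathbf q=(q_s)_{s\in S}$: each $s$-equivalence class has exactly $q_s+1$ elements; and assume $q_s\ge 2$ for all $s\in S$. For $w\in W$ with reduced expression $w=s_1\cdots s_k$ put $q_w=q_{s_1}\cdots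 q_{s_k}$ (this does not depend on the reduced expression), and let $$e_{\mathbf q}(W)=\limsup_{m\to\infty}\frac1m\log\bigl|\{w\in W : q_w\le e^m\}\bigr| .$$ Let $X_D=(\mathcal C\times D)/\!\sim$ be the Davis realization of $\mathcal C$. Here the Davis chamber $D$ is the simplicial complex whose $k$-simplices are the chains $T_0\subsetneq\cdots\subsetneq T_k$ of subsets of $S$ (possibly $T_0=\emptyset$) with all $W_{T_i}$ finite, and the copies of such a simplex indexed by $c$ and $c'$ are identified if and only if $d_W(c,c')\in W_{T_0}$. Let $n=\dim X_D$. For $1<p<\infty$ let $\ell^pH_k(X_D)=\ker\partial_k/\operatorname{im}\partial_{k+1}$ be the homology of the complex of $p$-summable real simplicial chains of $X_D$, and let $\ell^p\overline{H^k}(X_D)=\ker d_k/\overline{\operatorname{im} d_{k-1}}$ be the reduced cohomology of the complex of $p$-summable real simplicial cochains, the closure being taken in the $\ell^p$-norm. Then $$\inf\{p>1 : \ell^pH_n(X_D)\ne 0\}=1+e_{\mathbf q}(W),\qquad \sup\{p>1 : \ell^p\overline{H^n}(X_D)\ne 0\}=1+e_{\mathbf q}(W)^{-1},$$ where $e_{\mathbf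 q}(W)^{-1}=\infty$ if $e_{\mathbf q}(W)=0$. -/

import Mathlib

open scoped ENNReal

noncomputable section

universe u v w

/-! ## Finite simplicial complexes: orientable gallery connected pseudomanifolds -/

namespace PreAbstractSimplicialComplex

variable {V : Type u} (K : PreAbstractSimplicialComplex V)

/-- Every maximal simplex of `K` has dimension `d`. -/
def IsPure (d : ℕ) : Prop :=
  ∀ σ ∈ K, ∃ ρ ∈ K, σ ⊆ ρ ∧ ρ.card = d + 1 ∧ ∀ ρ' ∈ K, ρ ⊆ ρ' → ρ' = ρ

/-- The maximal simplices of a purely `d`-dimensional complex. -/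
def facets (d : ℕ) : Set (Finset V) := {σ | σ ∈ K ∧ σ.card = d + 1}

/-- The simplices of codimension one of a purely `d`-dimensional complex. The empty set counts as
a simplex of dimension `-1`, so that it is the face of codimension one when `d = 0`. -/
def ridges (d : ℕ) : Set (Finset V) := {τ | (τ ∈ K ∨ τ = ∅) ∧ τ.card = d}

/-- A purely `d`-dimensional complex in which every simplex of codimension one lies in exactly two
maximal simplices (local finiteness is automatic for the complexes on a finite vertex set to which
this is applied). -/
def IsPseudomanifold (d : ℕ) : Prop :=
  K.IsPure d ∧ ∀ τ ∈ K.ridges d, {σ ∈ K.facets d | τ ⊆ σ}.ncard = 2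

/-- Any two maximal simplices are joined by a sequence of maximal simplices in which consecutive
ones share a face of codimension one. -/
def IsGalleryConnected (d : ℕ) : Prop :=
  ∀ σ ∈ K.facets d, ∀ ρ ∈ K.facets d,
    Relation.ReflTransGen
      (fun α β : Finset V => α ∈ K.facets d ∧ β ∈ K.facets d ∧ ∃ τ, τ ⊆ α ∧ τ ⊆ β ∧ τ.card = d)
      σ ρ

open Classical in
/-- The maximal simplices can be oriented so that their sum is a cycle. All simplices carry
a reference orientation given by an ordering `f` of the vertices, and the orientation of `σ`
differs from it by the sign `ε σ`; the equation says that the coefficient of the boundary of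
`∑ ε σ • σ` at each simplex `τ` of codimension one vanishes. -/
def IsOrientable [Fintype V] (d : ℕ) : Prop :=
  ∃ f : V → ℕ, Function.Injective f ∧ ∃ ε : Finset V → ℤˣ, ∀ τ ∈ K.ridges d,
    ∑ v with v ∉ τ ∧ insert v τ ∈ K,
      (-1 : ℤ) ^ (τ.filter fun u => f u < f v).card * (ε (insert v τ) : ℤ) = 0

end PreAbstractSimplicialComplex

/-! ## Coxeter systems -/

namespace CoxeterSystem

variable {S : Type u} {W : Type v} [Group W] {M : CoxeterMatrix S} (cs : CoxeterSystem M W)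

/-- The standard parabolic subgroup `W_T`. -/
def parabolic (T : Set S) : Subgroup W := Subgroup.closure (cs.simple '' T)

theorem parabolic_mono {T T' : Set S} (h : T ⊆ T') : cs.parabolic T ≤ cs.parabolic T' :=
  Subgroup.closure_mono (Set.image_mono h)

/-- `W_T` is finite. -/
def IsSpherical (T : Finset S) : Prop := (cs.parabolic (T : Set S) : Set W).Finite

theorem IsSpherical.subset {cs : CoxeterSystem M W} {T T' : Finset S} (h : cs.IsSpherical T')
    (hT : T ⊆ T') : cs.IsSpherical T :=
  Set.Finite.subset h (cs.parabolic_mono (by exact_mod_cast hT))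

/-- The poset of all (possibly empty) subsets `T` of `S` with `W_T` finite. -/
abbrev Spherical := {T : Finset S // cs.IsSpherical T}

/-- The nerve: the simplicial complex of all nonempty `T ⊆ S` with `W_T` finite. -/
def nerve : PreAbstractSimplicialComplex S where
  faces := {T | T.Nonempty ∧ cs.IsSpherical T}
  isRelLowerSet_faces := fun _ h => ⟨h.1, fun _ hT hne => ⟨hne, h.2.subset hT⟩⟩

/-- The nerve is an orientable, gallery connected pseudomanifold. -/
def IsTypePM [Fintype S] : Prop :=
  ∃ d : ℕ, cs.nerve.IsPseudomanifold d ∧ cs.nerve.IsOrientable d ∧ cs.nerve.IsGalleryConnected d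

/-- `q_w = q_{s_1} ⋯ q_{s_k}` for a reduced expression `w = s_1 ⋯ s_k`. If `q` comes from
a regular building, the product does not depend on the chosen reduced expression. -/
def weight (q : S → ℕ) (w : W) : ℕ := ((cs.exists_isReduced w).choose.map q).prod

/-- `e_q(W) = limsup_n (1 / n) log #{w | q_w ≤ e ^ n}`, an element of `[0, ∞]`. -/
def growthRate (q : S → ℕ) : ℝ≥0∞ :=
  Filter.limsup (fun n : ℕ => ENNReal.ofReal
    (Real.log ({w : W | (cs.weight q w : ℝ) ≤ Real.exp n}.ncard : ℝ) / n)) Filter.atTop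

end CoxeterSystem

/-! ## Buildings -/

/-- A chamber system over `S` with set of chambers `C`. -/
structure ChamberSystem (S : Type u) (C : Type w) where
  /-- `s`-equivalence of chambers -/
  rel : S → Setoid C

namespace ChamberSystem

variable {S : Type u} {C : Type w} (X : ChamberSystem S C)

/-- `s`-equivalent and not equal. -/
def Adj (s : S) (c c' : C) : Prop := (X.rel s).r c c' ∧ c ≠ c'

/-- `X.Gallery ω c c'`: there is a gallery of type `ω` from `c` to `c'`. -/
inductive Gallery : List S → C → C → Prop
  | nil (c : C) : Gallery [] c c
  | cons {s : S} {ω : List S} {c c' c'' : C} :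
      X.Adj s c c' → Gallery ω c' c'' → Gallery (s :: ω) c c''

end ChamberSystem

/-- A (combinatorial) building of type `(W, S)` with set of chambers `C`. -/
structure Building {S : Type u} {W : Type v} [Group W] {M : CoxeterMatrix S}
    (cs : CoxeterSystem M W) (C : Type w) extends ChamberSystem S C where
  exists_adj : ∀ (s : S) (c : C), ∃ c', toChamberSystem.Adj s c c'
  /-- the `W`-valued distance -/
  dist : C → C → W
  gallery_iff : ∀ ω : List S, cs.IsReduced ω → ∀ c c' : C,
    toChamberSystem.Gallery ω c c' ↔ dist c c' = cs.wordProd ω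

namespace ChamberSystem

variable {S : Type u} {C : Type w} {X : ChamberSystem S C}

theorem Adj.symm {s : S} {c c' : C} (h : X.Adj s c c') : X.Adj s c' c :=
  ⟨(X.rel s).symm h.1, h.2.symm⟩

theorem gallery_append {ω ω' : List S} {c c' : C} :
    X.Gallery (ω ++ ω') c c' ↔ ∃ x, X.Gallery ω c x ∧ X.Gallery ω' x c' := by
  induction ω generalizing c with
  | nil =>
    constructor
    · intro h; exact ⟨c, .nil c, h⟩
    · rintro ⟨x, h, h'⟩; cases h; exact h'
  | cons s ω ih =>
    constructor
    · intro h
      cases h with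
      | cons ha hg =>
        obtain ⟨x, hx, hx'⟩ := ih.1 hg
        exact ⟨x, .cons ha hx, hx'⟩
    · rintro ⟨x, h, h'⟩
      cases h with
      | cons ha hg => exact .cons ha (ih.2 ⟨x, hg, h'⟩)

theorem gallery_singleton {s : S} {c c' : C} : X.Gallery [s] c c' ↔ X.Adj s c c' := by
  constructor
  · intro h
    cases h with
    | cons ha hg => cases hg; exact ha
  · intro h; exact .cons h (.nil _)

theorem Gallery.reverse {ω : List S} {c c' : C} (h : X.Gallery ω c c') :
    X.Gallery ω.reverse c' c := by
  induction h with
  | nil c => exact .nil c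
  | cons ha _ ih =>
    rw [List.reverse_cons]
    exact gallery_append.2 ⟨_, ih, gallery_singleton.2 ha.symm⟩

end ChamberSystem

namespace Building

variable {S : Type u} {W : Type v} [Group W] {M : CoxeterMatrix S} {cs : CoxeterSystem M W}
  {C : Type w} (B : Building cs C)

/-- Every `s`-equivalence class is finite. -/
def FiniteThickness : Prop := ∀ (s : S) (c : C), {c' | (B.rel s).r c c'}.Finite

/-- Regularity with thickness vector `q + 1`: every `s`-equivalence class has exactly `q s + 1`
elements (in particular it is finite). -/
def IsRegular (q : S → ℕ) : Prop := ∀ (s : S) (c : C), {c' | (B.rel s).r c c'}.ncard = q s + 1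

variable {B} in
theorem IsRegular.finiteThickness {q : S → ℕ} (h : B.IsRegular q) : B.FiniteThickness :=
  fun s c => Set.finite_of_ncard_ne_zero (by rw [h s c]; omega)

theorem dist_self (c : C) : B.dist c c = 1 := by
  have h := (B.gallery_iff [] (by simp [CoxeterSystem.IsReduced]) c c).1 (.nil c)
  simpa using h

theorem dist_comm (c c' : C) : B.dist c' c = (B.dist c c')⁻¹ := by
  obtain ⟨ω, hω, h⟩ := cs.exists_isReduced (B.dist c c')
  have := (B.gallery_iff ω.reverse hω.reverse c' c).1 ((B.gallery_iff ω hω c c').2 h).reverse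
  rw [this, h, cs.wordProd_reverse]

theorem dist_eq_of_adj_of_lt {c c' c'' : C} {s : S} (h : B.Adj s c' c'')
    (hl : cs.length (B.dist c c') < cs.length (B.dist c c' * cs.simple s)) :
    B.dist c c'' = B.dist c c' * cs.simple s := by
  obtain ⟨ω, hω, hw⟩ := cs.exists_isReduced (B.dist c c')
  have hω' : cs.IsReduced (ω ++ [s]) := by
    have h1 : cs.length (B.dist c c' * cs.simple s) ≤ (ω ++ [s]).length := by
      rw [hw, ← cs.wordProd_singleton, ← cs.wordProd_append]
      exact cs.length_wordProd_le _
    have h2 : cs.length (B.dist c c') = ω.length := by rw [hw]; exact hω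
    unfold CoxeterSystem.IsReduced
    rw [cs.wordProd_append, cs.wordProd_singleton, ← hw]
    simp only [List.length_append, List.length_singleton] at h1 ⊢
    omega
  have := (B.gallery_iff _ hω' c c'').1 (ChamberSystem.gallery_append.2
    ⟨c', (B.gallery_iff ω hω c c').2 hw, ChamberSystem.gallery_singleton.2 h⟩)
  rw [this, cs.wordProd_append, cs.wordProd_singleton, ← hw]

theorem exists_dist_eq_of_lt {c c' : C} {s : S}
    (hl : cs.length (B.dist c c' * cs.simple s) < cs.length (B.dist c c')) :
    ∃ x, B.dist c x = B.dist c c' * cs.simple s ∧ B.Adj s x c' := by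
  obtain ⟨ω, hω, hw⟩ := cs.exists_isReduced (B.dist c c' * cs.simple s)
  have hd : cs.wordProd (ω ++ [s]) = B.dist c c' := by
    rw [cs.wordProd_append, cs.wordProd_singleton, ← hw, mul_assoc, cs.simple_mul_simple_self,
      mul_one]
  have hω' : cs.IsReduced (ω ++ [s]) := by
    have h1 : cs.length (B.dist c c' * cs.simple s) = ω.length := by rw [hw]; exact hω
    have h2 := cs.length_wordProd_le (ω ++ [s])
    unfold CoxeterSystem.IsReduced
    rw [hd] at h2 ⊢
    simp only [List.length_append, List.length_singleton] at h2 ⊢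
    omega
  obtain ⟨x, hx, hx'⟩ := ChamberSystem.gallery_append.1 ((B.gallery_iff _ hω' c c').2 hd.symm)
  exact ⟨x, ((B.gallery_iff ω hω c x).1 hx).trans hw.symm, ChamberSystem.gallery_singleton.1 hx'⟩

theorem dist_of_adj {c c' c'' : C} {s : S} (h : B.Adj s c' c'') :
    B.dist c c'' = B.dist c c' ∨ B.dist c c'' = B.dist c c' * cs.simple s := by
  rcases lt_or_gt_of_ne (cs.length_mul_simple_ne (B.dist c c') s) with hl | hl
  · obtain ⟨x, hx, hxc⟩ := B.exists_dist_eq_of_lt hl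
    by_cases hxc'' : x = c''
    · subst hxc''; exact Or.inr hx
    · left
      have hadj : B.Adj s x c'' := ⟨(B.rel s).trans hxc.1 h.1, hxc''⟩
      have := B.dist_eq_of_adj_of_lt (c := c) hadj (by
        rw [hx, mul_assoc, cs.simple_mul_simple_self, mul_one]; exact hl)
      rw [this, hx, mul_assoc, cs.simple_mul_simple_self, mul_one]
  · exact Or.inr (B.dist_eq_of_adj_of_lt h hl)

theorem dist_mem_of_adj {T : Set S} {s : S} (hs : s ∈ T) {c c' c'' : C} (h : B.Adj s c' c'')
    (hc : B.dist c c' ∈ cs.parabolic T) : B.dist c c'' ∈ cs.parabolic T := by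
  rcases B.dist_of_adj (c := c) h with e | e <;> rw [e]
  · exact hc
  · exact mul_mem hc (Subgroup.subset_closure ⟨s, hs, rfl⟩)

theorem dist_mem_trans {T : Set S} {c c' c'' : C} (h : B.dist c c' ∈ cs.parabolic T)
    (h' : B.dist c' c'' ∈ cs.parabolic T) : B.dist c c'' ∈ cs.parabolic T := by
  have key : ∀ g ∈ cs.parabolic T, ∀ y, B.dist c' y = g → B.dist c y ∈ cs.parabolic T := by
    have step : ∀ (g : W) (s : S), s ∈ T →
        (∀ y, B.dist c' y = g → B.dist c y ∈ cs.parabolic T) →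
        ∀ y, B.dist c' y = g * cs.simple s → B.dist c y ∈ cs.parabolic T := by
      intro g s hs ih y hy
      have hg : B.dist c' y * cs.simple s = g := by
        rw [hy, mul_assoc, cs.simple_mul_simple_self, mul_one]
      rcases lt_or_gt_of_ne (cs.length_mul_simple_ne (B.dist c' y) s) with hl | hl
      · obtain ⟨x, hx, hxy⟩ := B.exists_dist_eq_of_lt hl
        exact B.dist_mem_of_adj hs hxy (ih x (hx.trans hg))
      · obtain ⟨z, hz⟩ := B.exists_adj s y
        exact B.dist_mem_of_adj hs hz.symm
          (ih z ((B.dist_eq_of_adj_of_lt hz hl).trans hg))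
    intro g hg
    induction hg using Subgroup.closure_induction_right with
    | one =>
      intro y hy
      have : B.Gallery [] c' y := (B.gallery_iff [] (by simp [CoxeterSystem.IsReduced]) c' y).2
        (by simpa using hy)
      cases this
      exact h
    | mul_right x _ y hy ih =>
      obtain ⟨s, hs, rfl⟩ := hy
      exact step x s hs ih
    | mul_inv_cancel x _ y hy ih =>
      obtain ⟨s, hs, rfl⟩ := hy
      rw [cs.inv_simple]
      exact step x s hs ih
  exact key _ h' c'' rfl

/-- The equivalence relation `d_W(c, c') ∈ W_T` on chambers. -/
def residue (T : Finset S) : Setoid C where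
  r c c' := B.dist c c' ∈ cs.parabolic (T : Set S)
  iseqv :=
    { refl := fun c => by rw [B.dist_self]; exact one_mem _
      symm := fun h => by rw [B.dist_comm]; exact inv_mem h
      trans := fun h h' => B.dist_mem_trans h h' }

theorem residue_mono {T T' : Finset S} (h : T ⊆ T') {c c' : C} (hc : (B.residue T).r c c') :
    (B.residue T').r c c' :=
  cs.parabolic_mono (by exact_mod_cast h) hc

variable {B} in
theorem FiniteThickness.finite_residue (hB : B.FiniteThickness) {T : Finset S}
    (hT : cs.IsSpherical T) (c : C) : {c' | (B.residue T).r c c'}.Finite := by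
  have hgal : ∀ (ω : List S) (c : C), {c' | B.Gallery ω c c'}.Finite := by
    intro ω
    induction ω with
    | nil =>
      intro c
      refine (Set.finite_singleton c).subset ?_
      intro c' h
      cases h
      rfl
    | cons s ω ih =>
      intro c
      refine ((hB s c).biUnion fun x _ => ih x).subset ?_
      intro c' h
      cases h with
      | cons ha hg => exact Set.mem_biUnion ha.1 hg
  refine (Set.Finite.biUnion hT (t := fun w => {c' | B.dist c c' = w}) fun w _ => ?_).subset ?_
  · obtain ⟨ω, hω, rfl⟩ := cs.exists_isReduced w
    exact (hgal ω c).subset fun c' h => (B.gallery_iff ω hω c c').2 h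
  · intro c' h
    exact Set.mem_biUnion (x := B.dist c c') h rfl

end Building

/-! ## Locally finite complexes with ordered simplices, and their `ℓ^p`-(co)homology -/

/-- A locally finite complex whose simplices have totally ordered vertices: sets of `k`-simplices,
and the `i`-th face of a `(k+1)`-simplex, obtained by deleting its `i`-th vertex. -/
structure OrderedComplex where
  /-- the `k`-simplices -/
  simplex : ℕ → Type u
  face : ∀ {k : ℕ}, Fin (k + 2) → simplex (k + 1) → simplex k
  face_face : ∀ {k : ℕ} (i j : Fin (k + 2)), i ≤ j → ∀ x : simplex (k + 2),
    face i (face j.succ x) = face j (face i.castSucc x)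
  finite_cofaces : ∀ {k : ℕ} (i : Fin (k + 2)) (y : simplex k), {x | face i x = y}.Finite

namespace OrderedComplex

variable (X : OrderedComplex.{u})

/-- `n` is the dimension of `X`. -/
def HasDim (n : ℕ) : Prop := IsGreatest {k | Nonempty (X.simplex k)} n

/-- `∂ (∑ a_σ σ) = ∑ a_σ ∑ᵢ (-1)^i ∂ᵢσ`, on arbitrary (locally finite) chains. -/
def boundarySucc (k : ℕ) : (X.simplex (k + 1) → ℝ) →ₗ[ℝ] (X.simplex k → ℝ) where
  toFun a y := ∑ i : Fin (k + 2), (-1) ^ (i : ℕ) * ∑ x ∈ (X.finite_cofaces i y).toFinset, a x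
  map_add' a b := by
    ext y
    simp [Finset.sum_add_distrib, mul_add]
  map_smul' r a := by
    ext y
    simp only [Pi.smul_apply, smul_eq_mul, ← Finset.mul_sum, RingHom.id_apply]
    rw [Finset.mul_sum]
    exact Finset.sum_congr rfl fun i _ => by ring

/-- `(dω)(σ) = ∑ᵢ (-1)^i ω(∂ᵢσ)`, on arbitrary cochains. -/
def coboundary (k : ℕ) : (X.simplex k → ℝ) →ₗ[ℝ] (X.simplex (k + 1) → ℝ) where
  toFun b x := ∑ i : Fin (k + 2), (-1) ^ (i : ℕ) * b (X.face i x)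
  map_add' a b := by
    ext y
    simp [Finset.sum_add_distrib, mul_add]
  map_smul' r a := by
    ext y
    simp only [Pi.smul_apply, smul_eq_mul, RingHom.id_apply]
    rw [Finset.mul_sum]
    exact Finset.sum_congr rfl fun i _ => by ring

variable (p : ℝ≥0∞) [Fact (1 ≤ p)]

/-- The real Banach space of `p`-summable families indexed by the `k`-simplices; it is the space
of `ℓ^p`-chains as well as that of `ℓ^p`-cochains. -/
abbrev lpChain (k : ℕ) : Type u := lp (fun _ : X.simplex k => ℝ) p

/-- The inclusion of `ℓ^p`-(co)chains into all (co)chains. -/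
def incl (k : ℕ) : X.lpChain p k →ₗ[ℝ] (X.simplex k → ℝ) where
  toFun a := a
  map_add' _ _ := rfl
  map_smul' _ _ := rfl

/-- `ℓ^p Z_k`, the kernel of `∂_k` (where `∂_0 = 0`). -/
def lpCycles : (k : ℕ) → Submodule ℝ (X.lpChain p k)
  | 0 => ⊤
  | k + 1 => LinearMap.ker (X.boundarySucc k ∘ₗ X.incl p (k + 1))

/-- `ℓ^p B_k`, the `ℓ^p`-chains which are the boundary of an `ℓ^p`-chain. -/
def lpBoundaries (k : ℕ) : Submodule ℝ (X.lpChain p k) :=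
  (LinearMap.range (X.boundarySucc k ∘ₗ X.incl p (k + 1))).comap (X.incl p k)

/-- `ℓ^p H_k = ℓ^p Z_k / ℓ^p B_k`. -/
abbrev LpHomology (k : ℕ) : Type u :=
  X.lpCycles p k ⧸ (X.lpBoundaries p k).submoduleOf (X.lpCycles p k)

/-- `ℓ^p Z^k`, the kernel of `d_k`. -/
def lpCocycles (k : ℕ) : Submodule ℝ (X.lpChain p k) :=
  LinearMap.ker (X.coboundary k ∘ₗ X.incl p k)

/-- `ℓ^p B^k`, the `ℓ^p`-cochains which are the coboundary of an `ℓ^p`-cochain. -/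
def lpCoboundaries : (k : ℕ) → Submodule ℝ (X.lpChain p k)
  | 0 => ⊥
  | k + 1 => (LinearMap.range (X.coboundary k ∘ₗ X.incl p k)).comap (X.incl p (k + 1))

/-- Reduced `ℓ^p`-cohomology: `ℓ^p Z^k` modulo the closure of `ℓ^p B^k` in the `ℓ^p`-norm. -/
abbrev ReducedLpCohomology (k : ℕ) : Type u :=
  X.lpCocycles p k ⧸ (X.lpCoboundaries p k).topologicalClosure.submoduleOf (X.lpCocycles p k)

end OrderedComplex

/-! ## The Davis realization -/

namespace Building

variable {S : Type u} {W : Type v} [Group W] {M : CoxeterMatrix S} {cs : CoxeterSystem M W}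
  {C : Type w} (B : Building cs C)

/-- The `k`-simplices of the Davis realization `(C × D) / ∼`. A `k`-simplex of the Davis chamber
`D` is a chain `σ = (T_0 ⊂ ⋯ ⊂ T_k)` of subsets generating finite parabolic subgroups; its
interior lies in the mirror `D_s` exactly if `s ∈ T_0`, so `(c, σ) ∼ (c', σ)` if and only if
`d_W(c, c') ∈ W_{T_0}`. -/
def DavisSimplex (k : ℕ) : Type (max u w) :=
  Σ σ : Fin (k + 1) ↪o cs.Spherical, Quotient (B.residue (σ 0).1)

/-- `(c, σ) ↦ (c, ∂ᵢσ)`, where `∂ᵢσ` omits `T_i`. -/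
def davisFace {k : ℕ} (i : Fin (k + 2)) (x : B.DavisSimplex (k + 1)) : B.DavisSimplex k :=
  ⟨(Fin.succAboveOrderEmb i).trans x.1,
    Quotient.map id (fun _ _ h => B.residue_mono (x.1.monotone (Fin.zero_le _)) h) x.2⟩

theorem davisFace_mk {k : ℕ} (i : Fin (k + 2)) (σ : Fin (k + 2) ↪o cs.Spherical) (c : C) :
    B.davisFace i ⟨σ, Quotient.mk _ c⟩ = ⟨(Fin.succAboveOrderEmb i).trans σ, Quotient.mk _ c⟩ :=
  rfl

theorem davisSimplex_mk_eq {k : ℕ} {σ τ : Fin (k + 1) ↪o cs.Spherical} (h : σ = τ) (c : C) :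
    (⟨σ, Quotient.mk _ c⟩ : B.DavisSimplex k) = ⟨τ, Quotient.mk _ c⟩ := by
  subst h; rfl

variable {B} in
/-- The Davis realization of a building of finite thickness. -/
def davisRealization [Finite S] (hB : B.FiniteThickness) : OrderedComplex where
  simplex := B.DavisSimplex
  face := B.davisFace
  face_face := by
    rintro k i j hij ⟨σ, ⟨c⟩⟩
    refine B.davisSimplex_mk_eq ?_ c
    have h : ∀ a : Fin (k + 1), j.succ.succAbove (i.succAbove a)
        = i.castSucc.succAbove (j.succAbove a) := by
      intro a
      dsimp [Fin.succAbove]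
      rcases i with ⟨i, _⟩
      rcases j with ⟨j, _⟩
      rcases a with ⟨a, _⟩
      split_ifs <;> · simp at * <;> lia
    ext1 a
    exact congrArg σ (h a)
  finite_cofaces := by
    rintro k i ⟨τ, ⟨c⟩⟩
    have : Finite (Fin (k + 2) ↪o cs.Spherical) := DFunLike.finite _
    refine (Set.finite_iUnion fun σ : Fin (k + 2) ↪o cs.Spherical =>
      (hB.finite_residue (τ 0).2 c).image
        fun c' => (⟨σ, Quotient.mk _ c'⟩ : B.DavisSimplex (k + 1))).subset ?_
    rintro ⟨σ, ⟨c'⟩⟩ h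
    refine Set.mem_iUnion.2 ⟨σ, c', ?_, rfl⟩
    have h' : (⟨(Fin.succAboveOrderEmb i).trans σ, Quotient.mk _ c'⟩ : B.DavisSimplex k)
        = ⟨τ, Quotient.mk _ c⟩ := h
    obtain ⟨h1, h2⟩ := Sigma.mk.inj_iff.1 h'
    subst h1
    exact (B.residue _).symm (Quotient.exact (eq_of_heq h2))

end Building

theorem fact_one_le_ofReal {p : ℝ} (hp : 1 < p) : Fact (1 ≤ ENNReal.ofReal p) :=
  ⟨by simpa using hp.le⟩

end

/-!
Let `q_w` be the number of chambers at `W`-distance `w` from a given chamber. Everything reduces to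
the convergence of the Dirichlet series `∑_w q_w ^ (-t)`, whose abscissa of convergence is the
growth rate `e`.

A simplex of top dimension `n = d + 1` is a chamber together with a chain `∅ ⊂ T_1 ⊂ ⋯ ⊂ T_n`, and
such chains are the same as orderings of the vertices of the facets of the nerve
(`CoxeterSystem.Frame`). A face omitting some `T_i` with `i ≥ 1` lies in exactly two top
simplices, which belong to one chamber; hence, by gallery connectedness, a cycle is determined up
to sign on each chamber by one number, and the orientability of the nerve makes every system of
numbers fit (`Frame.rel_of_isGalleryConnected`, `Frame.sign_last`). A face omitting `∅` lies in the
simplices belonging to the chambers of a panel. So the cycles of top dimension are the functions on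
the set of chambers which sum to zero over every panel
(`FiniteThickness.boundarySucc_eq_zero_iff`).

If `φ` is such a function, passing from the sphere of `w` to the sphere of `ws`, where
`ℓ(ws) > ℓ(w)`, changes the sign of the sum of `φ`; so this sum is `± φ c` on all spheres around
`c`, and the power mean inequality bounds the `p`-norm of `φ` on the sphere of `w` from below by
`q_w ^ (1 - p) |φ c| ^ p`. Conversely `(-1) ^ ℓ(w) / q_w` is such a function. Hence there are nonzero
`ℓ^p`-cycles exactly if `∑ q_w ^ (1 - p)` converges (`IsRegular.lpCycles_ne_bot_iff`). As there are
no simplices of higher dimension, this settles homology, and by the theorem of Hahn and Banach the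
reduced `ℓ^p`-cohomology is nonzero exactly if there are nonzero cycles for the conjugate exponent
`p'`, where `p' - 1 = (p - 1)⁻¹` (`topologicalClosure_lpCoboundaries_ne_top_iff`).
-/

open scoped ENNReal

noncomputable section

universe u v w

/-! ### Growth rate and the series of powers of the weights -/

namespace CoxeterSystem

variable {S : Type u} {W : Type v} [Group W] {M : CoxeterMatrix S} (cs : CoxeterSystem M W)

theorem two_pow_length_le_weight {q : S → ℕ} (hq : ∀ s, 2 ≤ q s) (w : W) :
    2 ^ cs.length w ≤ cs.weight q w := by
  have hω := (cs.exists_isReduced w).choose_spec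
  set ω := (cs.exists_isReduced w).choose with hdef
  have hlen : cs.length w = ω.length := by
    conv_lhs => rw [hω.2]
    exact hω.1
  have : cs.weight q w = (ω.map q).prod := rfl
  rw [this, hlen, ← List.length_map (f := q)]
  refine List.pow_card_le_prod _ _ ?_
  intro x hx
  obtain ⟨s, -, rfl⟩ := List.mem_map.1 hx
  exact hq s

theorem one_le_weight {q : S → ℕ} (hq : ∀ s, 2 ≤ q s) (w : W) : 1 ≤ cs.weight q w :=
  Nat.one_le_two_pow.trans (cs.two_pow_length_le_weight hq w)

theorem weight_pos {q : S → ℕ} (hq : ∀ s, 2 ≤ q s) (w : W) : (0 : ℝ) < cs.weight q w := by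
  exact_mod_cast cs.one_le_weight hq w

theorem finite_length_le [Finite S] (L : ℕ) : {w : W | cs.length w ≤ L}.Finite := by
  refine ((List.finite_length_le S L).image cs.wordProd).subset fun w hw => ?_
  obtain ⟨ω, hω, rfl⟩ := cs.exists_isReduced w
  exact ⟨ω, by rw [Set.mem_ofPred_eq, ← hω.eq]; exact hw, rfl⟩

theorem finite_weight_le [Finite S] {q : S → ℕ} (hq : ∀ s, 2 ≤ q s) (R : ℝ) :
    {w : W | (cs.weight q w : ℝ) ≤ R}.Finite := by
  obtain ⟨L, hL⟩ := pow_unbounded_of_one_lt R (one_lt_two)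
  refine (cs.finite_length_le L).subset fun w hw => ?_
  have h1 : ((2 ^ cs.length w : ℕ) : ℝ) ≤ cs.weight q w := by
    exact_mod_cast cs.two_pow_length_le_weight hq w
  have h2 : (2 : ℝ) ^ cs.length w < 2 ^ L := by
    push_cast at h1
    exact (h1.trans hw).trans_lt hL
  exact ((pow_lt_pow_iff_right₀ one_lt_two).1 h2).le

theorem summable_pow_length (S : Type u) [Finite S] {r : ℝ} (hr : 0 ≤ r)
    (h : Nat.card S * r < 1) : Summable fun ω : List S => r ^ ω.length := by
  have := Fintype.ofFinite S
  rw [← List.equivSigmaTuple.symm.summable_iff, summable_sigma_of_nonneg]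
  · refine ⟨fun n => Summable.of_finite, ?_⟩
    have : (fun n => ∑' x : Fin n → S, ((fun ω : List S => r ^ ω.length) ∘
        List.equivSigmaTuple.symm) ⟨n, x⟩) = fun n => (Nat.card S * r) ^ n := by
      funext n
      simp [List.equivSigmaTuple, tsum_fintype, mul_pow]
    rw [this]
    exact summable_geometric_of_lt_one (by positivity) h
  · intro x
    simp only [Function.comp]
    positivity

/-- The series `∑ q_w ^ (-t)` is dominated by a geometric series over all words. -/
theorem exists_summable_weight_rpow [Finite S] {q : S → ℕ} (hq : ∀ s, 2 ≤ q s) :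
    ∃ t : ℝ, 0 < t ∧ Summable fun w : W => (cs.weight q w : ℝ) ^ (-t) := by
  obtain ⟨k, hk⟩ := pow_unbounded_of_one_lt (Nat.card S : ℝ) (one_lt_two)
  refine ⟨k + 1, by positivity, ?_⟩
  have hr : (Nat.card S : ℝ) * (2 ^ (k + 1))⁻¹ < 1 := by
    rw [← div_eq_mul_inv, div_lt_one (by positivity), pow_succ]
    linarith [pow_pos (zero_lt_two (α := ℝ)) k]
  have hs := summable_pow_length S (by positivity) hr
  let word : W → List S := fun w => (cs.exists_isReduced w).choose
  have hword : ∀ w, cs.length w = (word w).length ∧ w = cs.wordProd (word w) := fun w => by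
    have h := (cs.exists_isReduced w).choose_spec
    refine ⟨?_, h.2⟩
    conv_lhs => rw [h.2]
    exact h.1
  have hinj : Function.Injective word := fun w w' h => by
    rw [(hword w).2, (hword w').2, h]
  refine (hs.comp_injective hinj).of_nonneg_of_le
    (fun w => Real.rpow_nonneg (Nat.cast_nonneg _) _) fun w => ?_
  have h1 : ((2 ^ cs.length w : ℕ) : ℝ) ≤ cs.weight q w := by
    exact_mod_cast cs.two_pow_length_le_weight hq w
  push_cast at h1
  have h2 : (cs.weight q w : ℝ) ^ (-((k : ℝ) + 1)) ≤ ((2 : ℝ) ^ cs.length w) ^ (-((k : ℝ) + 1)) :=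
    Real.rpow_le_rpow_of_nonpos (by positivity) h1 (by linarith [k.cast_nonneg (α := ℝ)])
  refine h2.trans_eq ?_
  have h3 : -((k : ℝ) + 1) = -((k + 1 : ℕ) : ℝ) := by push_cast; ring
  simp only [Function.comp]
  rw [h3, Real.rpow_neg (by positivity), Real.rpow_natCast, ← (hword w).1, inv_pow, ← pow_mul,
    ← pow_mul, mul_comm]

/-- If the series `∑ q_w ^ (-t)` converges, the growth rate is at most `t`. -/
theorem growthRate_le [Finite S] {q : S → ℕ} (hq : ∀ s, 2 ≤ q s) {t : ℝ} (ht : 0 < t)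
    (h : Summable fun w : W => (cs.weight q w : ℝ) ^ (-t)) :
    cs.growthRate q ≤ ENNReal.ofReal t := by
  set K : ℝ := ∑' w : W, (cs.weight q w : ℝ) ^ (-t) with hK
  have hpos : ∀ w : W, 0 < (cs.weight q w : ℝ) ^ (-t) := fun w =>
    Real.rpow_pos_of_pos (cs.weight_pos hq w) _
  have hKpos : 0 < K := h.tsum_pos (fun w => (hpos w).le) 1 (hpos 1)
  have hcount : ∀ n : ℕ, ({w : W | (cs.weight q w : ℝ) ≤ Real.exp n}.ncard : ℝ) ≤
      K * Real.exp (n * t) := by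
    intro n
    have hfin := cs.finite_weight_le hq (Real.exp n)
    rw [Set.ncard_eq_toFinset_card _ hfin]
    have h1 : ∑ w ∈ hfin.toFinset, Real.exp (-(n * t)) ≤ K := by
      refine (Finset.sum_le_sum fun w hw => ?_).trans
        (h.sum_le_tsum hfin.toFinset fun w _ => (hpos w).le)
      have hw' : (cs.weight q w : ℝ) ≤ Real.exp n := by simpa using hw
      have h2 := Real.rpow_le_rpow_of_nonpos (cs.weight_pos hq w) hw'
        (neg_nonpos.2 ht.le)
      rwa [← Real.exp_mul, mul_neg] at h2
    rw [Finset.sum_const, nsmul_eq_mul, Real.exp_neg] at h1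
    rwa [← div_eq_mul_inv, div_le_iff₀ (Real.exp_pos _)] at h1
  have hbound : ∀ n : ℕ, 0 < n →
      Real.log ({w : W | (cs.weight q w : ℝ) ≤ Real.exp n}.ncard : ℝ) / n ≤
      t + |Real.log K| / n := by
    intro n hn
    have hn' : (0 : ℝ) < n := by exact_mod_cast hn
    rw [div_le_iff₀ hn', add_mul, div_mul_cancel₀ _ hn'.ne']
    rcases Nat.eq_zero_or_pos ({w : W | (cs.weight q w : ℝ) ≤ Real.exp n}.ncard) with h0 | h0
    · rw [h0]
      simp only [Nat.cast_zero, Real.log_zero]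
      positivity
    · have h2 := Real.log_le_log (by exact_mod_cast h0) (hcount n)
      rw [Real.log_mul hKpos.ne' (Real.exp_pos _).ne', Real.log_exp] at h2
      linarith [le_abs_self (Real.log K)]
  have hlim : Filter.Tendsto (fun n : ℕ => ENNReal.ofReal (t + |Real.log K| / n)) Filter.atTop
      (nhds (ENNReal.ofReal t)) := by
    refine ENNReal.tendsto_ofReal ?_
    simpa using tendsto_const_nhds.add (tendsto_const_div_atTop_nhds_zero_nat |Real.log K|)
  rw [growthRate, ← hlim.limsup_eq]
  refine Filter.limsup_le_limsup ?_
  filter_upwards [Filter.eventually_gt_atTop 0] with n hn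
  exact ENNReal.ofReal_le_ofReal (hbound n hn)

theorem growthRate_ne_top [Finite S] {q : S → ℕ} (hq : ∀ s, 2 ≤ q s) : cs.growthRate q ≠ ⊤ := by
  obtain ⟨t, ht, h⟩ := cs.exists_summable_weight_rpow hq
  exact ((cs.growthRate_le hq ht h).trans_lt ENNReal.ofReal_lt_top).ne

/-- The series `∑ q_w ^ (-t)` converges if `t` exceeds the growth rate. -/
theorem summable_weight_rpow [Finite S] {q : S → ℕ} (hq : ∀ s, 2 ≤ q s) {t : ℝ}
    (ht : cs.growthRate q < ENNReal.ofReal t) :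
    Summable fun w : W => (cs.weight q w : ℝ) ^ (-t) := by
  obtain ⟨t', ht'0, h1, h2⟩ := ENNReal.lt_iff_exists_real_btwn.1 ht
  have htt : t' < t := (ENNReal.ofReal_lt_ofReal_iff_of_nonneg ht'0).1 h2
  have htpos : 0 < t := ht'0.trans_lt htt
  let N : ℕ → ℕ := fun n => {w : W | (cs.weight q w : ℝ) ≤ Real.exp n}.ncard
  have hev : ∀ᶠ n : ℕ in Filter.atTop, (N n : ℝ) ≤ Real.exp (n * t') := by
    have := Filter.eventually_lt_of_limsup_lt h1
    filter_upwards [this, Filter.eventually_gt_atTop 0] with n hn hn0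
    have hn' : (0 : ℝ) < n := by exact_mod_cast hn0
    have h3 : Real.log (N n : ℝ) / n ≤ t' := (ENNReal.ofReal_le_ofReal_iff ht'0).1 hn.le
    rw [div_le_iff₀ hn'] at h3
    rcases Nat.eq_zero_or_pos (N n) with h0 | h0
    · rw [h0]; simpa using (Real.exp_pos _).le
    · rw [← Real.log_le_iff_le_exp (by exact_mod_cast h0)]
      linarith
  -- group the elements `w` by `n = ⌈log q_w⌉`: at most `N n` of them, each with
  -- `q_w ^ (-t) ≤ exp (-(n - 1) t)`
  have hsum : Summable fun n : ℕ => (N n : ℝ) * Real.exp (-((n - 1) * t)) := by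
    have hg : Summable fun n : ℕ => Real.exp t * Real.exp (t' - t) ^ n := by
      refine (summable_geometric_of_lt_one (Real.exp_pos _).le ?_).mul_left _
      rw [Real.exp_lt_one_iff]
      linarith
    refine hg.of_norm_bounded_eventually_nat ?_
    filter_upwards [hev] with n hn
    rw [Real.norm_of_nonneg (by positivity)]
    refine (mul_le_mul_of_nonneg_right hn (Real.exp_pos _).le).trans_eq ?_
    rw [← Real.exp_nat_mul, ← Real.exp_add, ← Real.exp_add]
    congr 1
    ring
  let κ : W → ℕ := fun w => ⌈Real.log (cs.weight q w : ℝ)⌉₊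
  refine summable_of_sum_le (c := ∑' n : ℕ, (N n : ℝ) * Real.exp (-((n - 1) * t)))
    (fun w => Real.rpow_nonneg (Nat.cast_nonneg _) _) fun F => ?_
  classical
  rw [← Finset.sum_fiberwise_of_maps_to (t := F.image κ) (g := κ)
    fun w hw => Finset.mem_image_of_mem _ hw]
  refine (Finset.sum_le_sum fun n _ => ?_).trans
    (hsum.sum_le_tsum (F.image κ) fun n _ => by positivity)
  have hfin := cs.finite_weight_le hq (Real.exp n)
  have hcard : ((F.filter fun w => κ w = n).card : ℝ) ≤ N n := by
    have : (F.filter fun w => κ w = n) ⊆ hfin.toFinset := by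
      intro w hw
      have hw' := (Finset.mem_filter.1 hw).2
      rw [Set.Finite.mem_toFinset, Set.mem_ofPred_eq,
        ← Real.log_le_iff_le_exp (cs.weight_pos hq w), ← hw']
      exact Nat.le_ceil _
    have h5 := Finset.card_le_card this
    rw [← Set.ncard_eq_toFinset_card _ hfin] at h5
    exact_mod_cast h5
  refine (Finset.sum_le_card_nsmul _ _ (Real.exp (-((n - 1) * t))) fun w hw => ?_).trans ?_
  · have hw' := (Finset.mem_filter.1 hw).2
    rw [Real.rpow_def_of_pos (cs.weight_pos hq w)]
    refine Real.exp_le_exp.2 ?_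
    have hlog : 0 ≤ Real.log (cs.weight q w : ℝ) :=
      Real.log_nonneg (by exact_mod_cast cs.one_le_weight hq w)
    have h6 : (n : ℝ) < Real.log (cs.weight q w : ℝ) + 1 := by
      rw [← hw']; exact Nat.ceil_lt_add_one hlog
    nlinarith
  · rw [nsmul_eq_mul]
    exact mul_le_mul_of_nonneg_right hcard (Real.exp_pos _).le

end CoxeterSystem

/-! ### Spheres in a building and functions summing to zero over panels -/

namespace Building

variable {S : Type u} {W : Type v} [Group W] {M : CoxeterMatrix S} {cs : CoxeterSystem M W}
  {C : Type w} {B : Building cs C}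

theorem dist_eq_one_iff {c c' : C} : B.dist c c' = 1 ↔ c = c' := by
  constructor
  · intro h
    have : B.Gallery [] c c' := (B.gallery_iff [] (by simp [CoxeterSystem.IsReduced]) c c').2
      (by simpa using h)
    cases this
    rfl
  · rintro rfl
    exact B.dist_self c

theorem dist_eq_simple_iff {c c' : C} {s : S} : B.dist c c' = cs.simple s ↔ B.Adj s c c' := by
  have h := B.gallery_iff [s] (by simp [CoxeterSystem.IsReduced]) c c'
  rw [ChamberSystem.gallery_singleton, cs.wordProd_singleton] at h
  exact h.symm

/-- The panel of type `s` containing the chamber `c`, i.e. its `s`-equivalence class. -/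
def FiniteThickness.panel (hB : B.FiniteThickness) (s : S) (c : C) : Finset C := (hB s c).toFinset

theorem FiniteThickness.mem_panel (hB : B.FiniteThickness) {s : S} {c c' : C} :
    c' ∈ hB.panel s c ↔ (B.rel s).r c c' := by
  simp [panel]

theorem FiniteThickness.self_mem_panel (hB : B.FiniteThickness) (s : S) (c : C) :
    c ∈ hB.panel s c :=
  hB.mem_panel.2 ((B.rel s).refl c)

theorem FiniteThickness.panel_eq (hB : B.FiniteThickness) {s : S} {c c' : C}
    (h : (B.rel s).r c c') : hB.panel s c' = hB.panel s c := by
  ext x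
  rw [hB.mem_panel, hB.mem_panel]
  exact ⟨fun h' => (B.rel s).trans h h', fun h' => (B.rel s).trans ((B.rel s).symm h) h'⟩

theorem IsRegular.card_panel {q : S → ℕ} (h : B.IsRegular q) (s : S) (c : C) :
    (h.finiteThickness.panel s c).card = q s + 1 := by
  rw [FiniteThickness.panel, ← Set.ncard_eq_toFinset_card _ (h.finiteThickness s c)]
  exact h s c

/-- A real function on the chambers which sums to zero over every panel. -/
def FiniteThickness.IsAlternating (hB : B.FiniteThickness) (φ : C → ℝ) : Prop :=
  ∀ s c, ∑ x ∈ hB.panel s c, φ x = 0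

theorem FiniteThickness.finite_sphere (hB : B.FiniteThickness) (c : C) (w : W) :
    {c' | B.dist c c' = w}.Finite := by
  obtain ⟨ω, hω, rfl⟩ := cs.exists_isReduced w
  refine Set.Finite.subset (s := {c' | B.Gallery ω c c'}) ?_
    fun c' h => (B.gallery_iff ω hω c c').2 h
  clear hω
  induction ω generalizing c with
  | nil =>
    refine (Set.finite_singleton c).subset ?_
    intro c' h
    cases h
    rfl
  | cons s ω ih =>
    refine ((hB s c).biUnion fun x _ => ih x).subset ?_
    intro c' h
    cases h with
    | cons ha hg => exact Set.mem_biUnion ha.1 hg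

/-- The chambers at `W`-distance `w` from `c`. -/
def FiniteThickness.sphere (hB : B.FiniteThickness) (c : C) (w : W) : Finset C :=
  (hB.finite_sphere c w).toFinset

theorem FiniteThickness.mem_sphere (hB : B.FiniteThickness) {c c' : C} {w : W} :
    c' ∈ hB.sphere c w ↔ B.dist c c' = w := by
  simp [sphere]

/-- Every panel contains a chamber whose distance to `c` is shortest. -/
theorem exists_rel_length_lt (B : Building cs C) (c c' : C) (s : S) : ∃ x, (B.rel s).r c' x ∧
    cs.length (B.dist c x) < cs.length (B.dist c x * cs.simple s) := by
  rcases lt_or_gt_of_ne (cs.length_mul_simple_ne (B.dist c c') s) with hl | hl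
  · obtain ⟨x, hx, hxc⟩ := B.exists_dist_eq_of_lt hl
    refine ⟨x, (B.rel s).symm hxc.1, ?_⟩
    rw [hx, mul_assoc, cs.simple_mul_simple_self, mul_one]
    exact hl
  · exact ⟨c', (B.rel s).refl c', hl⟩

open Classical in
/-- If `ℓ(ws) > ℓ(w)`, the sphere of `ws` is the disjoint union of the panels of type `s` through
the chambers of the sphere of `w`, with these chambers removed. -/
theorem FiniteThickness.sum_sphere_mul_simple (hB : B.FiniteThickness) (c : C) {w : W} {s : S}
    (hl : cs.length w < cs.length (w * cs.simple s)) (g : C → ℝ) :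
    ∑ x ∈ hB.sphere c (w * cs.simple s), g x =
      ∑ y ∈ hB.sphere c w, ∑ x ∈ (hB.panel s y).erase y, g x := by
  have hsphere : hB.sphere c (w * cs.simple s) =
      (hB.sphere c w).biUnion fun y => (hB.panel s y).erase y := by
    ext x
    simp only [Finset.mem_biUnion, hB.mem_sphere, Finset.mem_erase, hB.mem_panel]
    constructor
    · intro hx
      have h1 : B.dist c x * cs.simple s = w := by
        rw [hx, mul_assoc, cs.simple_mul_simple_self, mul_one]
      obtain ⟨y, hy, hyx⟩ := B.exists_dist_eq_of_lt (c := c) (c' := x) (s := s)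
        (by rw [h1, hx]; exact hl)
      exact ⟨y, hy.trans h1, hyx.2.symm, hyx.1⟩
    · rintro ⟨y, rfl, hne, hr⟩
      exact B.dist_eq_of_adj_of_lt ⟨hr, hne.symm⟩ hl
  rw [hsphere, Finset.sum_biUnion]
  intro y hy y' hy' hne
  rw [Function.onFun, Finset.disjoint_left]
  intro x hx hx'
  simp only [Finset.mem_coe, hB.mem_sphere] at hy hy'
  rw [Finset.mem_erase, hB.mem_panel] at hx hx'
  -- two chambers of the sphere of `w` in one panel would have `W`-distances `w` and `ws` to `c`
  have hadj : B.Adj s y y' := ⟨(B.rel s).trans hx.2 ((B.rel s).symm hx'.2), hne⟩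
  have h1 := B.dist_eq_of_adj_of_lt (c := c) hadj (by rw [hy]; exact hl)
  rw [hy, hy'] at h1
  rw [← h1] at hl
  exact lt_irrefl _ hl

/-- `cs.length` induction along right multiplication by simple reflections. -/
theorem _root_.CoxeterSystem.induction_length (cs : CoxeterSystem M W) {P : W → Prop} (one : P 1)
    (step : ∀ w s, cs.length w < cs.length (w * cs.simple s) → P w → P (w * cs.simple s))
    (w : W) : P w := by
  induction hn : cs.length w using Nat.strong_induction_on generalizing w with
  | _ n ih =>
    by_cases hw : w = 1
    · rw [hw]; exact one
    · obtain ⟨s, hs⟩ := cs.exists_rightDescent_of_ne_one hw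
      have h1 : w * cs.simple s * cs.simple s = w := by
        rw [mul_assoc, cs.simple_mul_simple_self, mul_one]
      have := step (w * cs.simple s) s (by rw [h1]; exact hs) (ih _ (hn ▸ hs) _ rfl)
      rwa [h1] at this

theorem FiniteThickness.sphere_one (hB : B.FiniteThickness) (c : C) : hB.sphere c 1 = {c} := by
  ext x
  rw [hB.mem_sphere, dist_eq_one_iff, Finset.mem_singleton, eq_comm]

theorem IsRegular.card_sphere_mul_simple {q : S → ℕ} (h : B.IsRegular q) (c : C) {w : W} {s : S}
    (hl : cs.length w < cs.length (w * cs.simple s)) :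
    (h.finiteThickness.sphere c (w * cs.simple s)).card =
      (h.finiteThickness.sphere c w).card * q s := by
  classical
  have h1 := h.finiteThickness.sum_sphere_mul_simple c hl fun _ => 1
  have h2 : ∀ y ∈ h.finiteThickness.sphere c w,
      ∑ x ∈ (h.finiteThickness.panel s y).erase y, (1 : ℝ) = q s := by
    intro y _
    rw [Finset.sum_const, Finset.card_erase_of_mem (h.finiteThickness.self_mem_panel s y),
      h.card_panel]
    simp
  rw [Finset.sum_congr rfl h2] at h1
  simp only [Finset.sum_const, nsmul_eq_mul, mul_one] at h1
  exact_mod_cast h1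

/-- The weight `q_w` is the number of chambers at `W`-distance `w` from a given chamber. -/
theorem IsRegular.card_sphere {q : S → ℕ} (h : B.IsRegular q) (c : C) (w : W) :
    (h.finiteThickness.sphere c w).card = cs.weight q w := by
  have key : ∀ ω : List S, cs.IsReduced ω →
      (h.finiteThickness.sphere c (cs.wordProd ω)).card = (ω.map q).prod := by
    intro ω
    induction ω using List.reverseRecOn with
    | nil => intro _; simp [h.finiteThickness.sphere_one]
    | append_singleton ω s ih =>
      intro hω
      have hω' : cs.IsReduced ω := by simpa using hω.take ω.length
      rw [cs.wordProd_append, cs.wordProd_singleton, h.card_sphere_mul_simple, ih hω']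
      · simp
      · rw [← cs.wordProd_singleton, ← cs.wordProd_append, hω.eq, hω'.eq]
        simp
  have hω := (cs.exists_isReduced w).choose_spec
  conv_lhs => rw [hω.2]
  exact key _ hω.1

theorem IsRegular.weight_mul_simple [Nonempty C] {q : S → ℕ} (h : B.IsRegular q) {w : W} {s : S}
    (hl : cs.length w < cs.length (w * cs.simple s)) :
    cs.weight q (w * cs.simple s) = cs.weight q w * q s := by
  obtain ⟨c⟩ := ‹Nonempty C›
  rw [← h.card_sphere c, ← h.card_sphere c, h.card_sphere_mul_simple c hl]

/-- The sums over spheres of a function which sums to zero over the panels of type `s` change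
sign when passing from `w` to `ws`. -/
theorem FiniteThickness.sum_sphere_mul_simple_eq_neg (hB : B.FiniteThickness) (c : C) {w : W}
    {s : S} (hl : cs.length w < cs.length (w * cs.simple s)) {φ : C → ℝ}
    (hφ : hB.IsAlternating φ) :
    ∑ x ∈ hB.sphere c (w * cs.simple s), φ x = -∑ x ∈ hB.sphere c w, φ x := by
  classical
  rw [hB.sum_sphere_mul_simple c hl, ← Finset.sum_neg_distrib]
  refine Finset.sum_congr rfl fun y _ => ?_
  have := Finset.add_sum_erase _ φ (hB.self_mem_panel s y)
  rw [hφ s y] at this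
  linarith

theorem FiniteThickness.abs_sum_sphere (hB : B.FiniteThickness) (c : C) (w : W) {φ : C → ℝ}
    (hφ : hB.IsAlternating φ) : |∑ x ∈ hB.sphere c w, φ x| = |φ c| := by
  induction w using cs.induction_length with
  | one => rw [hB.sphere_one, Finset.sum_singleton]
  | step w s hl ih => rw [hB.sum_sphere_mul_simple_eq_neg c hl hφ, abs_neg, ih]

/-- A nonzero `p`-summable function summing to zero over all panels forces `∑ q_w ^ (1 - p)` to
converge: by the power mean inequality, the part of the `p`-norm over the sphere of `w` is at least
`q_w ^ (1 - p) |φ c| ^ p`. -/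
theorem IsRegular.summable_weight_of_isAlternating {q : S → ℕ} (hq : ∀ s, 2 ≤ q s)
    (h : B.IsRegular q) {p : ℝ} (hp : 1 < p) {φ : C → ℝ} (hφ : h.finiteThickness.IsAlternating φ)
    (hsum : Summable fun c => |φ c| ^ p) {c : C} (hc : φ c ≠ 0) :
    Summable fun w : W => (cs.weight q w : ℝ) ^ (-(p - 1)) := by
  have hc' : 0 < |φ c| ^ p := Real.rpow_pos_of_pos (abs_pos.2 hc) _
  have key : ∀ w : W, (cs.weight q w : ℝ) ^ (-(p - 1)) ≤
      (|φ c| ^ p)⁻¹ * ∑ x ∈ h.finiteThickness.sphere c w, |φ x| ^ p := by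
    intro w
    have h1 := Real.rpow_sum_le_const_mul_sum_rpow (h.finiteThickness.sphere c w) φ hp.le
    rw [h.card_sphere] at h1
    have h2 : |φ c| ^ p ≤ (∑ x ∈ h.finiteThickness.sphere c w, |φ x|) ^ p := by
      rw [← h.finiteThickness.abs_sum_sphere c w hφ]
      exact Real.rpow_le_rpow (abs_nonneg _) (Finset.abs_sum_le_sum_abs _ _) (by linarith)
    have h3 := h2.trans h1
    have hw := cs.weight_pos hq w
    rw [Real.rpow_neg hw.le, inv_mul_eq_div, le_div_iff₀ hc', inv_mul_le_iff₀
      (Real.rpow_pos_of_pos hw _)]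
    exact h3
  refine summable_of_sum_le (c := (|φ c| ^ p)⁻¹ * ∑' x, |φ x| ^ p)
    (fun w => Real.rpow_nonneg (Nat.cast_nonneg _) _) fun F => ?_
  refine (Finset.sum_le_sum fun w _ => key w).trans ?_
  rw [← Finset.mul_sum]
  refine mul_le_mul_of_nonneg_left ?_ (inv_nonneg.2 hc'.le)
  classical
  rw [← Finset.sum_biUnion]
  · exact hsum.sum_le_tsum _ fun x _ => Real.rpow_nonneg (abs_nonneg _) _
  · intro w _ w' _ hne
    rw [Function.onFun, Finset.disjoint_left]
    intro x hx hx'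
    rw [h.finiteThickness.mem_sphere] at hx hx'
    exact hne (hx.symm.trans hx')

/-- The function `c' ↦ (-1) ^ ℓ(w) / q_w`, where `w` is the `W`-distance from `c` to `c'`. -/
def radial (B : Building cs C) (q : S → ℕ) (c c' : C) : ℝ :=
  (-1) ^ cs.length (B.dist c c') / cs.weight q (B.dist c c')

theorem radial_self (B : Building cs C) {q : S → ℕ} (hq : ∀ s, 2 ≤ q s) (c : C) :
    B.radial q c c ≠ 0 :=
  div_ne_zero (pow_ne_zero _ (by norm_num)) (cs.weight_pos hq _).ne'

/-- A panel has one chamber at some shortest distance `w`, and `q s` chambers at distance `ws`, whose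
weight is `q_w q_s`. -/
theorem IsRegular.isAlternating_radial {q : S → ℕ} (hq : ∀ s, 2 ≤ q s) (h : B.IsRegular q)
    (c : C) : h.finiteThickness.IsAlternating (B.radial q c) := by
  classical
  intro s c'
  have : Nonempty C := ⟨c⟩
  obtain ⟨x, hx, hl⟩ := B.exists_rel_length_lt c c' s
  rw [← h.finiteThickness.panel_eq hx,
    ← Finset.add_sum_erase _ _ (h.finiteThickness.self_mem_panel s x)]
  have h1 : ∀ y ∈ (h.finiteThickness.panel s x).erase x, B.radial q c y =
      -((-1) ^ cs.length (B.dist c x) / (cs.weight q (B.dist c x) * q s)) := by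
    intro y hy
    rw [Finset.mem_erase, h.finiteThickness.mem_panel] at hy
    have h2 := B.dist_eq_of_adj_of_lt (c := c) ⟨hy.2, hy.1.symm⟩ hl
    have h3 : cs.length (B.dist c x * cs.simple s) = cs.length (B.dist c x) + 1 := by
      rcases cs.length_mul_simple (B.dist c x) s with h4 | h4 <;> omega
    rw [radial, h2, h.weight_mul_simple hl, h3, pow_succ]
    push_cast
    ring
  rw [Finset.sum_congr rfl h1, Finset.sum_const,
    Finset.card_erase_of_mem (h.finiteThickness.self_mem_panel s x), h.card_panel, radial]
  have hw := (cs.weight_pos hq (B.dist c x)).ne'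
  have hqs : (q s : ℝ) ≠ 0 := by
    have := hq s
    positivity
  simp only [Nat.add_sub_cancel, nsmul_eq_mul]
  field_simp
  ring

theorem IsRegular.summable_radial {q : S → ℕ} (hq : ∀ s, 2 ≤ q s) (h : B.IsRegular q) {p : ℝ}
    (hsum : Summable fun w : W => (cs.weight q w : ℝ) ^ (-(p - 1))) (c : C) :
    Summable fun c' => |B.radial q c c'| ^ p := by
  classical
  refine summable_of_sum_le (c := ∑' w : W, (cs.weight q w : ℝ) ^ (-(p - 1)))
    (fun _ => Real.rpow_nonneg (abs_nonneg _) _) fun F => ?_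
  rw [← Finset.sum_fiberwise_of_maps_to (t := F.image (B.dist c)) (g := B.dist c)
    fun x hx => Finset.mem_image_of_mem _ hx]
  refine (Finset.sum_le_sum fun w _ => ?_).trans
    (hsum.sum_le_tsum (F.image (B.dist c)) fun w _ => Real.rpow_nonneg (Nat.cast_nonneg _) _)
  have hw := cs.weight_pos hq w
  refine (Finset.sum_le_card_nsmul _ _ ((cs.weight q w : ℝ) ^ (-p)) fun x hx => ?_).trans ?_
  · rw [radial, (Finset.mem_filter.1 hx).2, abs_div, abs_pow, abs_neg, abs_one, one_pow,
      abs_of_pos hw, one_div, Real.inv_rpow hw.le, Real.rpow_neg hw.le]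
  · have hcard : (F.filter fun x => B.dist c x = w).card ≤ cs.weight q w := by
      rw [← h.card_sphere c]
      refine Finset.card_le_card fun x hx => ?_
      rw [h.finiteThickness.mem_sphere]
      exact (Finset.mem_filter.1 hx).2
    have h1 : (cs.weight q w : ℝ) ^ (-(p - 1)) = cs.weight q w * (cs.weight q w : ℝ) ^ (-p) := by
      rw [neg_sub, sub_eq_add_neg, Real.rpow_add hw, Real.rpow_one]
    rw [nsmul_eq_mul, h1]
    exact mul_le_mul_of_nonneg_right (by exact_mod_cast hcard) (Real.rpow_nonneg hw.le _)

end Building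

/-! ### Frames and the top-dimensional simplices of the Davis realization -/

namespace CoxeterSystem

variable {S : Type u} {W : Type v} [Group W] {M : CoxeterMatrix S} {cs : CoxeterSystem M W}
  {d : ℕ}

theorem mem_parabolic_empty (cs : CoxeterSystem M W) {w : W} :
    w ∈ cs.parabolic ((∅ : Finset S) : Set S) ↔ w = 1 := by
  simp [parabolic]

theorem mem_parabolic_singleton (cs : CoxeterSystem M W) {s : S} {w : W} :
    w ∈ cs.parabolic (({s} : Finset S) : Set S) ↔ w = 1 ∨ w = cs.simple s := by
  have h2 : cs.simple s ^ 2 = 1 := by rw [pow_two, cs.simple_mul_simple_self]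
  rw [parabolic, Finset.coe_singleton, Set.image_singleton, Subgroup.mem_closure_singleton]
  constructor
  · rintro ⟨n, rfl⟩
    rcases Int.even_or_odd' n with ⟨k, rfl | rfl⟩
    · left
      rw [zpow_mul, zpow_ofNat, h2, one_zpow]
    · right
      rw [zpow_add, zpow_mul, zpow_ofNat, h2, one_zpow, one_mul, zpow_one]
  · rintro (rfl | rfl)
    · exact ⟨0, zpow_zero _⟩
    · exact ⟨1, zpow_one _⟩

theorem isSpherical_singleton (cs : CoxeterSystem M W) (s : S) : cs.IsSpherical {s} :=
  (Set.toFinite {1, cs.simple s}).subset fun _ hw => cs.mem_parabolic_singleton.1 hw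

theorem card_le_of_isPure (h : cs.nerve.IsPure d) {T : Finset S} (hT : cs.IsSpherical T) :
    T.card ≤ d + 1 := by
  rcases T.eq_empty_or_nonempty with rfl | hne
  · simp
  · obtain ⟨ρ, -, hTρ, hρ, -⟩ := h T ⟨hne, hT⟩
    exact hρ ▸ Finset.card_le_card hTρ

theorem strictMono_card {k : ℕ} (σ : Fin (k + 1) ↪o cs.Spherical) :
    StrictMono fun i => (σ i).1.card :=
  fun _ _ h => Finset.card_lt_card (σ.strictMono h)

theorem le_of_isPure (h : cs.nerve.IsPure d) {k : ℕ} (σ : Fin (k + 1) ↪o cs.Spherical) :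
    k ≤ d + 1 := by
  have hinj : Function.Injective fun i : Fin (k + 1) =>
      (⟨(σ i).1.card, Nat.lt_succ_of_le (card_le_of_isPure h (σ i).2)⟩ : Fin (d + 2)) := by
    intro i j hij
    exact (strictMono_card σ).injective (congrArg Fin.val hij)
  have := Fintype.card_le_of_injective _ hinj
  simp only [Fintype.card_fin] at this
  omega

/-- In a chain of maximal length, the `i`-th set has `i` elements. -/
theorem card_of_isPure (h : cs.nerve.IsPure d) (σ : Fin (d + 2) ↪o cs.Spherical)
    (i : Fin (d + 2)) : (σ i).1.card = i := by
  let f : Fin (d + 2) → Fin (d + 2) := fun i =>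
    ⟨(σ i).1.card, Nat.lt_succ_of_le (card_le_of_isPure h (σ i).2)⟩
  have hf : StrictMono f := fun i j hij => strictMono_card σ hij
  exact congrArg Fin.val (le_antisymm hf.apply_le hf.le_apply : f i = i)

/-- The set of the values `v j` with `j < i`. -/
def initial (v : Fin (d + 1) ↪ S) (i : Fin (d + 2)) : Finset S :=
  (Finset.univ.filter fun j : Fin (d + 1) => j.castSucc < i).map v

theorem mem_initial {v : Fin (d + 1) ↪ S} {i : Fin (d + 2)} {x : S} :
    x ∈ initial v i ↔ ∃ j : Fin (d + 1), j.castSucc < i ∧ v j = x := by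
  simp [initial]

theorem apply_mem_initial {v : Fin (d + 1) ↪ S} {i : Fin (d + 2)} {j : Fin (d + 1)} :
    v j ∈ initial v i ↔ j.castSucc < i := by
  simp [mem_initial]

@[simp] theorem initial_zero (v : Fin (d + 1) ↪ S) : initial v 0 = ∅ := by
  ext x; simp [mem_initial]

theorem initial_one (v : Fin (d + 1) ↪ S) : initial v 1 = {v 0} := by
  ext x
  rw [mem_initial, Finset.mem_singleton]
  constructor
  · rintro ⟨j, hj, rfl⟩
    congr 1
    rw [Fin.lt_def] at hj
    ext
    simpa using hj
  · rintro rfl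
    exact ⟨0, by simp, rfl⟩

theorem initial_last (v : Fin (d + 1) ↪ S) :
    initial v (Fin.last (d + 1)) = Finset.univ.map v := by
  ext x; simp [mem_initial, Fin.castSucc_lt_last]

theorem initial_subset_map (v : Fin (d + 1) ↪ S) (i : Fin (d + 2)) :
    initial v i ⊆ Finset.univ.map v :=
  Finset.map_subset_map.2 (Finset.filter_subset _ _)

theorem initial_strictMono (v : Fin (d + 1) ↪ S) : StrictMono (initial v) := by
  intro i j hij
  refine Finset.ssubset_iff_subset_ne.2 ⟨fun x hx => ?_, fun h => ?_⟩
  · obtain ⟨k, hk, rfl⟩ := mem_initial.1 hx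
    exact mem_initial.2 ⟨k, hk.trans hij, rfl⟩
  · have hi : (i : ℕ) < d + 1 := by have := j.2; have := Fin.lt_def.1 hij; omega
    have h1 : v ⟨i, hi⟩ ∈ initial v j := apply_mem_initial.2 hij
    rw [← h, apply_mem_initial] at h1
    exact lt_irrefl _ h1

theorem apply_eq_of_initial_eq {v v' : Fin (d + 1) ↪ S} {j : Fin (d + 1)}
    (h : initial v j.castSucc = initial v' j.castSucc) (h' : initial v j.succ = initial v' j.succ) :
    v j = v' j := by
  have h1 : v j ∈ initial v' j.succ := by
    rw [← h', apply_mem_initial]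
    exact Fin.castSucc_lt_succ
  obtain ⟨k, hk, hkj⟩ := mem_initial.1 h1
  have h2 : ¬ k.castSucc < j.castSucc := by
    intro hlt
    have h3 : v j ∈ initial v' j.castSucc := mem_initial.2 ⟨k, hlt, hkj⟩
    rw [← h, apply_mem_initial] at h3
    exact lt_irrefl _ h3
  have : k = j := by
    rw [Fin.lt_def] at hk h2
    simp only [Fin.val_castSucc, Fin.val_succ] at hk h2
    ext; omega
  rw [← hkj, this]

theorem apply_eq_of_forall_ne {v v' : Fin (d + 1) ↪ S} {i : Fin (d + 2)}
    (h : ∀ k, k ≠ i → initial v k = initial v' k) {j : Fin (d + 1)} (h1 : j.castSucc ≠ i)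
    (h2 : j.succ ≠ i) : v j = v' j :=
  apply_eq_of_initial_eq (h _ h1) (h _ h2)

theorem forall_ne_zero_initial_eq_iff {v v' : Fin (d + 1) ↪ S} :
    (∀ k, k ≠ 0 → initial v k = initial v' k) ↔ v = v' := by
  constructor
  · intro h
    ext j
    have h0 : ∀ k, initial v k = initial v' k := by
      intro k
      by_cases hk : k = 0
      · subst hk; simp
      · exact h k hk
    exact apply_eq_of_initial_eq (h0 _) (h0 _)
  · rintro rfl _ _
    rfl

theorem forall_ne_last_initial_eq_iff {v v' : Fin (d + 1) ↪ S} :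
    (∀ k, k ≠ Fin.last (d + 1) → initial v k = initial v' k) ↔
      ∀ j, j ≠ Fin.last d → v j = v' j := by
  constructor
  · intro h j hj
    refine apply_eq_of_forall_ne h (Fin.castSucc_lt_last j).ne fun h1 => hj ?_
    rw [← Fin.succ_last] at h1
    exact Fin.succ_injective _ h1
  · intro h k hk
    ext x
    rw [mem_initial, mem_initial]
    refine exists_congr fun j => and_congr_right fun hj => ?_
    rw [h j]
    rintro rfl
    have h1 := Fin.lt_def.1 hj
    have h2 := Fin.val_lt_last hk
    simp only [Fin.val_castSucc, Fin.val_last] at h1 h2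
    omega

/-- Two chains of initial sets which agree except at the rank `j + 1` come from orderings which are
equal or differ by the transposition of the vertices `j` and `j + 1`. -/
theorem forall_ne_initial_eq_iff {v v' : Fin (d + 1) ↪ S} {j : Fin d} :
    (∀ k, k ≠ j.castSucc.succ → initial v k = initial v' k) ↔
      v = v' ∨ (Equiv.swap j.castSucc j.succ).toEmbedding.trans v = v' := by
  constructor
  · intro h
    have hne : ∀ l, l ≠ j.castSucc → l ≠ j.succ → v l = v' l := by
      intro l h1 h2
      refine apply_eq_of_forall_ne h (fun h3 => h2 ?_) (fun h3 => h1 (Fin.succ_injective _ h3))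
      rw [Fin.succ_castSucc] at h3
      exact Fin.castSucc_injective _ h3
    have hrange : Finset.univ.map v = Finset.univ.map v' := by
      rw [← initial_last, ← initial_last]
      refine h _ fun h3 => ?_
      rw [Fin.succ_castSucc] at h3
      exact (Fin.castSucc_lt_last _).ne' h3
    have hmem : ∀ l, l = j.castSucc ∨ l = j.succ → v' l = v j.castSucc ∨ v' l = v j.succ := by
      intro l hl
      have h1 : v' l ∈ Finset.univ.map v := by rw [hrange]; simp
      obtain ⟨m, -, hm⟩ := Finset.mem_map.1 h1
      by_cases hm1 : m = j.castSucc
      · left; rw [← hm, hm1]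
      by_cases hm2 : m = j.succ
      · right; rw [← hm, hm2]
      rw [hne m hm1 hm2] at hm
      have := v'.injective hm
      subst this
      exact absurd hl (by tauto)
    have hjj : j.castSucc ≠ j.succ := Fin.castSucc_lt_succ.ne
    have hinj : v' j.castSucc ≠ v' j.succ := fun h => hjj (v'.injective h)
    rcases hmem j.castSucc (Or.inl rfl) with h1 | h1
    · left
      have h2 : v' j.succ = v j.succ := by
        rcases hmem j.succ (Or.inr rfl) with h2 | h2
        · exact absurd (h1.trans h2.symm) hinj
        · exact h2
      ext l
      by_cases hl1 : l = j.castSucc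
      · rw [hl1, h1]
      by_cases hl2 : l = j.succ
      · rw [hl2, h2]
      exact hne l hl1 hl2
    · right
      have h2 : v' j.succ = v j.castSucc := by
        rcases hmem j.succ (Or.inr rfl) with h2 | h2
        · exact h2
        · exact absurd (h1.trans h2.symm) hinj
      ext l
      simp only [Function.Embedding.trans_apply, Equiv.coe_toEmbedding]
      by_cases hl1 : l = j.castSucc
      · rw [hl1, h1, Equiv.swap_apply_left]
      by_cases hl2 : l = j.succ
      · rw [hl2, h2, Equiv.swap_apply_right]
      rw [Equiv.swap_apply_of_ne_of_ne hl1 hl2]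
      exact hne l hl1 hl2
  · rintro (rfl | rfl) k hk
    · rfl
    · have key : ∀ l : Fin (d + 1), (Equiv.swap j.castSucc j.succ l).castSucc < k ↔
          l.castSucc < k := by
        intro l
        have hk' : (k : ℕ) ≠ j + 1 := fun h => hk (Fin.ext (by simpa using h))
        rw [Equiv.swap_apply_def]
        split_ifs with h1 h2
        · subst h1
          simp only [Fin.lt_def, Fin.val_castSucc, Fin.val_succ]
          omega
        · subst h2
          simp only [Fin.lt_def, Fin.val_castSucc, Fin.val_succ]
          omega
        · rfl
      ext x
      rw [mem_initial, mem_initial]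
      constructor
      · rintro ⟨l, hl, rfl⟩
        exact ⟨Equiv.swap j.castSucc j.succ l, (key _).2 hl, by simp⟩
      · rintro ⟨l, hl, rfl⟩
        exact ⟨Equiv.swap j.castSucc j.succ l, (key _).2 hl, by simp⟩

/-- An injective enumeration of the vertices of a `d`-simplex of the nerve. If the nerve is purely
`d`-dimensional, frames correspond to the chains of maximal length in the poset of spherical
subsets, see `Frame.flag`. -/
def Frame (cs : CoxeterSystem M W) (d : ℕ) : Type u :=
  {v : Fin (d + 1) ↪ S // cs.IsSpherical (Finset.univ.map v)}

/-- The chain of the sets of the first `i` vertices of a frame, for `0 ≤ i ≤ d + 1`. -/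
def Frame.flag (v : cs.Frame d) : Fin (d + 2) ↪o cs.Spherical :=
  OrderEmbedding.ofStrictMono
    (fun i => ⟨initial v.1 i, v.2.subset (initial_subset_map v.1 i)⟩)
    fun _ _ h => initial_strictMono v.1 h

@[simp] theorem Frame.coe_flag (v : cs.Frame d) (i : Fin (d + 2)) :
    (v.flag i).1 = initial v.1 i := rfl

theorem Frame.card_initial (h : cs.nerve.IsPure d) (v : cs.Frame d) (i : Fin (d + 2)) :
    (initial v.1 i).card = i :=
  card_of_isPure h v.flag i

/-- Reordering the vertices of a frame. -/
def Frame.perm (v : cs.Frame d) (π : Equiv.Perm (Fin (d + 1))) : cs.Frame d :=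
  ⟨π.toEmbedding.trans v.1, by
    rw [← Finset.map_map]
    simpa using v.2⟩

theorem Frame.map_perm (v : cs.Frame d) (π : Equiv.Perm (Fin (d + 1))) :
    Finset.univ.map (v.perm π).1 = Finset.univ.map v.1 := by
  rw [Frame.perm, ← Finset.map_map]
  simp

theorem Frame.perm_apply (v : cs.Frame d) (π : Equiv.Perm (Fin (d + 1))) (j : Fin (d + 1)) :
    (v.perm π).1 j = v.1 (π j) := rfl

/-- Two frames which differ at most in their last vertex. -/
def Frame.AgreeOffLast (v v' : cs.Frame d) : Prop := ∀ j, j ≠ Fin.last d → v.1 j = v'.1 j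

theorem Frame.exists_flag_eq (h : cs.nerve.IsPure d) (σ : Fin (d + 2) ↪o cs.Spherical) :
    ∃ v : cs.Frame d, v.flag = σ := by
  have h1 : ∀ j : Fin (d + 1), ∃ x, x ∈ (σ j.succ).1 ∧ x ∉ (σ j.castSucc).1 := fun j =>
    Finset.exists_of_ssubset (σ.strictMono Fin.castSucc_lt_succ)
  choose f hf hf' using h1
  have hmono : ∀ {i j : Fin (d + 2)}, i ≤ j → (σ i).1 ⊆ (σ j).1 := fun hij => σ.monotone hij
  have hinj : Function.Injective f := by
    intro j k hjk
    by_contra hne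
    wlog hlt : j < k generalizing j k
    · exact this hjk.symm (Ne.symm hne) (lt_of_le_of_ne (not_lt.1 hlt) (Ne.symm hne))
    · refine hf' k (hjk ▸ hmono ?_ (hf j))
      rw [Fin.le_def]
      simpa using hlt
  have hsub : ∀ i, initial ⟨f, hinj⟩ i ⊆ (σ i).1 := by
    intro i x hx
    obtain ⟨j, hj, rfl⟩ := mem_initial.1 hx
    exact hmono (Fin.castSucc_lt_iff_succ_le.1 hj) (hf j)
  let v : cs.Frame d := ⟨⟨f, hinj⟩, (σ (Fin.last _)).2.subset (by
    rw [← initial_last]; exact hsub _)⟩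
  refine ⟨v, ?_⟩
  ext1 i
  refine Subtype.ext (Finset.eq_of_subset_of_card_le (hsub i) ?_)
  exact ((card_of_isPure h σ i).trans (card_of_isPure h v.flag i).symm).le

end CoxeterSystem

/-! ### Cycles of top dimension -/

namespace CoxeterSystem

variable {S : Type u} {W : Type v} [Group W] {M : CoxeterMatrix S} {cs : CoxeterSystem M W}
  {d : ℕ}

theorem exists_frame_map_eq {T : Finset S} (hT : cs.IsSpherical T) (hcard : T.card = d + 1) :
    ∃ v : cs.Frame d, Finset.univ.map v.1 = T := by
  let e : Fin (d + 1) ↪ S :=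
    (T.equivFinOfCardEq hcard).symm.toEmbedding.trans (Function.Embedding.subtype _)
  have he : Finset.univ.map e = T := by
    rw [← Finset.map_map]
    simp [Finset.attach_map_val]
  exact ⟨⟨e, by rwa [he]⟩, he⟩

theorem nonempty_frame [Infinite W] (h : cs.nerve.IsPure d) : Nonempty (cs.Frame d) := by
  have hS : Nonempty S := by
    by_contra hS
    rw [not_nonempty_iff] at hS
    have : ∀ w : W, w = 1 := fun w => by
      obtain ⟨ω, -, rfl⟩ := cs.exists_isReduced w
      cases ω with
      | nil => exact cs.wordProd_nil
      | cons s => exact hS.elim s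
    have hsub : Subsingleton W := ⟨fun a b => by rw [this a, this b]⟩
    exact not_finite_iff_infinite.2 ‹Infinite W› inferInstance
  obtain ⟨s⟩ := hS
  obtain ⟨ρ, hρ, -, hcard, -⟩ := h {s} ⟨⟨s, by simp⟩, cs.isSpherical_singleton s⟩
  obtain ⟨v, -⟩ := exists_frame_map_eq hρ.2 hcard
  exact ⟨v⟩

theorem initial_castSucc_last_eq_erase [DecidableEq S] (v : Fin (d + 1) ↪ S) :
    initial v (Fin.last d).castSucc = (Finset.univ.map v).erase (v (Fin.last d)) := by
  ext x
  simp only [mem_initial, Finset.mem_erase, Finset.mem_map, Finset.mem_univ, true_and]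
  constructor
  · rintro ⟨j, hj, rfl⟩
    refine ⟨fun h => ?_, j, rfl⟩
    rw [v.injective h] at hj
    exact lt_irrefl _ hj
  · rintro ⟨hne, j, rfl⟩
    refine ⟨j, ?_, rfl⟩
    rw [Fin.castSucc_lt_castSucc_iff]
    exact Fin.lt_last_iff_ne_last.2 fun h => hne (by rw [h])

theorem Frame.AgreeOffLast.eq_of_map_eq {v v' : cs.Frame d} (h : v.AgreeOffLast v')
    (hmap : Finset.univ.map v.1 = Finset.univ.map v'.1) : v = v' := by
  have h1 : v.1 (Fin.last d) ∈ Finset.univ.map v'.1 := by rw [← hmap]; simp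
  obtain ⟨j, -, hj⟩ := Finset.mem_map.1 h1
  have hj' : j = Fin.last d := by
    by_contra hne
    rw [← h j hne] at hj
    exact hne (v.1.injective hj)
  subst hj'
  refine Subtype.ext (Function.Embedding.ext fun l => ?_)
  by_cases hl : l = Fin.last d
  · rw [hl, hj]
  · exact h l hl

theorem Frame.AgreeOffLast.initial_eq {v v' : cs.Frame d} (h : v.AgreeOffLast v') :
    initial v.1 (Fin.last d).castSucc = initial v'.1 (Fin.last d).castSucc :=
  forall_ne_last_initial_eq_iff.2 h _ (Fin.castSucc_lt_last _).ne

/-- The set of all but the last vertices of a frame is a ridge of the nerve. -/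
theorem Frame.initial_mem_ridges (h : cs.nerve.IsPure d) (v : cs.Frame d) :
    initial v.1 (Fin.last d).castSucc ∈ cs.nerve.ridges d := by
  refine ⟨?_, by simpa using v.card_initial h (Fin.last d).castSucc⟩
  rcases (initial v.1 (Fin.last d).castSucc).eq_empty_or_nonempty with h0 | h0
  · exact Or.inr h0
  · exact Or.inl ⟨h0, v.2.subset (initial_subset_map _ _)⟩

theorem Frame.map_mem_facets (v : cs.Frame d) :
    Finset.univ.map v.1 ∈ cs.nerve.facets d :=
  ⟨⟨⟨v.1 0, by simp⟩, v.2⟩, by simp⟩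

theorem Frame.exists_agreeOffLast (h : cs.nerve.IsPure d) (v : cs.Frame d) {F : Finset S}
    (hF : F ∈ cs.nerve.facets d) (hsub : initial v.1 (Fin.last d).castSucc ⊆ F) :
    ∃ v' : cs.Frame d, v.AgreeOffLast v' ∧ Finset.univ.map v'.1 = F := by
  have hcard := v.card_initial h (Fin.last d).castSucc
  simp only [Fin.val_castSucc, Fin.val_last] at hcard
  obtain ⟨b, hb, hb'⟩ : ∃ b ∈ F, b ∉ initial v.1 (Fin.last d).castSucc := by
    by_contra! hcon
    have := Finset.card_le_card (s := F) hcon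
    rw [hcard, hF.2] at this
    omega
  have hb2 : b ∉ Set.range (Fin.Embedding.init v.1) := by
    rintro ⟨j, rfl⟩
    exact hb' (apply_mem_initial.2 (Fin.castSucc_lt_castSucc_iff.2 (Fin.castSucc_lt_last j)))
  have hmap : Finset.univ.map (Fin.Embedding.snoc (Fin.Embedding.init v.1) hb2) = F := by
    refine Finset.eq_of_subset_of_card_le (fun x hx => ?_) (by rw [hF.2]; simp)
    obtain ⟨j, -, rfl⟩ := Finset.mem_map.1 hx
    induction j using Fin.lastCases with
    | last => rwa [Fin.Embedding.snoc_last]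
    | cast j =>
      rw [Fin.Embedding.snoc_castSucc]
      exact hsub (apply_mem_initial.2
        (Fin.castSucc_lt_castSucc_iff.2 (Fin.castSucc_lt_last j)))
  refine ⟨⟨Fin.Embedding.snoc (Fin.Embedding.init v.1) hb2, by rw [hmap]; exact hF.1.2⟩, ?_, hmap⟩
  intro j hj
  induction j using Fin.lastCases with
  | last => exact absurd rfl hj
  | cast j =>
    change _ = Fin.Embedding.snoc (Fin.Embedding.init v.1) hb2 j.castSucc
    rw [Fin.Embedding.snoc_castSucc]
    rfl

/-- The ridge spanned by all but the last vertices lies in a second facet. -/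
theorem exists_other_agreeOffLast (h : cs.nerve.IsPseudomanifold d) (v : cs.Frame d) :
    ∃ v' : cs.Frame d, v ≠ v' ∧ v.AgreeOffLast v' := by
  obtain ⟨F, hF, hne⟩ := Set.exists_ne_of_one_lt_ncard
    (by rw [h.2 _ (v.initial_mem_ridges h.1)]; omega) (Finset.univ.map v.1)
  obtain ⟨v', hv', hmap⟩ := v.exists_agreeOffLast h.1 hF.1 hF.2
  exact ⟨v', fun h => hne (by rw [← hmap, h]), hv'⟩

/-- The ridge spanned by all but the last vertices lies in no third facet. -/
theorem eq_of_agreeOffLast (h : cs.nerve.IsPseudomanifold d) {v v' v'' : cs.Frame d}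
    (hv' : v.AgreeOffLast v') (hv'' : v.AgreeOffLast v'') (hne' : v ≠ v') (hne'' : v ≠ v'') :
    v' = v'' := by
  obtain ⟨F, G, -, hFG⟩ := Set.ncard_eq_two.1 (h.2 _ (v.initial_mem_ridges h.1))
  have hmem : ∀ u : cs.Frame d, v.AgreeOffLast u →
      Finset.univ.map u.1 = F ∨ Finset.univ.map u.1 = G := by
    intro u hu
    have : Finset.univ.map u.1 ∈ ({F, G} : Set (Finset S)) := by
      rw [← hFG]
      exact ⟨u.map_mem_facets, by rw [hu.initial_eq]; exact initial_subset_map _ _⟩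
    simpa using this
  have h0 := hmem v fun _ _ => rfl
  have h1 := hmem v' hv'
  have h2 := hmem v'' hv''
  have n1 : Finset.univ.map v.1 ≠ Finset.univ.map v'.1 := fun h => hne' (hv'.eq_of_map_eq h)
  have n2 : Finset.univ.map v.1 ≠ Finset.univ.map v''.1 := fun h => hne'' (hv''.eq_of_map_eq h)
  have h12 : v'.AgreeOffLast v'' := fun j hj => (hv' j hj).symm.trans (hv'' j hj)
  refine h12.eq_of_map_eq ?_
  rcases h0 with h0 | h0 <;> rcases h1 with h1 | h1 <;> rcases h2 with h2 | h2 <;> simp_all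

end CoxeterSystem

namespace Building

variable {S : Type u} {W : Type v} [Group W] {M : CoxeterMatrix S} {cs : CoxeterSystem M W}
  {C : Type w} {B : Building cs C} {d : ℕ}

open CoxeterSystem

theorem davisSimplex_mk_eq_iff {k : ℕ} {σ τ : Fin (k + 1) ↪o cs.Spherical} {c c' : C} :
    (⟨σ, Quotient.mk _ c⟩ : B.DavisSimplex k) = ⟨τ, Quotient.mk _ c'⟩ ↔
      σ = τ ∧ (B.residue (σ 0).1).r c c' := by
  constructor
  · intro h
    obtain ⟨h1, h2⟩ := Sigma.mk.inj_iff.1 h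
    subst h1
    exact ⟨rfl, Quotient.exact (eq_of_heq h2)⟩
  · rintro ⟨rfl, h⟩
    exact congrArg _ (Quotient.sound h)

theorem residue_empty_iff {c c' : C} : (B.residue ∅).r c c' ↔ c = c' :=
  (cs.mem_parabolic_empty).trans dist_eq_one_iff

theorem residue_singleton_iff {s : S} {c c' : C} : (B.residue {s}).r c c' ↔ (B.rel s).r c c' := by
  refine (cs.mem_parabolic_singleton).trans ?_
  rw [dist_eq_one_iff, dist_eq_simple_iff]
  constructor
  · rintro (rfl | h)
    · exact (B.rel s).refl _
    · exact h.1
  · intro h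
    by_cases hc : c = c'
    · exact Or.inl hc
    · exact Or.inr ⟨h, hc⟩

/-- The top-dimensional simplex of the Davis realization given by a frame and a chamber. -/
def frameSimplex (B : Building cs C) (v : cs.Frame d) (c : C) : B.DavisSimplex (d + 1) :=
  ⟨v.flag, Quotient.mk _ c⟩

theorem frameSimplex_inj {v v' : cs.Frame d} {c c' : C} :
    B.frameSimplex v c = B.frameSimplex v' c' ↔ v = v' ∧ c = c' := by
  refine davisSimplex_mk_eq_iff.trans ?_
  rw [Frame.coe_flag, initial_zero, residue_empty_iff]
  refine and_congr_left fun _ => ⟨fun h => ?_, fun h => by rw [h]⟩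
  refine Subtype.ext (forall_ne_zero_initial_eq_iff.1 fun k _ => ?_)
  rw [← Frame.coe_flag, h, Frame.coe_flag]

theorem exists_frameSimplex_eq (h : cs.nerve.IsPure d) (x : B.DavisSimplex (d + 1)) :
    ∃ v c, B.frameSimplex v c = x := by
  obtain ⟨σ, ⟨c⟩⟩ := x
  obtain ⟨v, rfl⟩ := Frame.exists_flag_eq h σ
  exact ⟨v, c, rfl⟩

theorem davisFace_frameSimplex_eq_iff {v v' : cs.Frame d} {c c' : C} {i : Fin (d + 2)} :
    B.davisFace i (B.frameSimplex v c) = B.davisFace i (B.frameSimplex v' c') ↔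
      (∀ k, k ≠ i → initial v.1 k = initial v'.1 k) ∧
        (B.residue (initial v.1 (i.succAbove 0))).r c c' := by
  refine (davisSimplex_mk_eq_iff (σ := (Fin.succAboveOrderEmb i).trans v.flag)
    (τ := (Fin.succAboveOrderEmb i).trans v'.flag)).trans (and_congr ?_ Iff.rfl)
  constructor
  · intro h k hk
    obtain ⟨j, rfl⟩ := Fin.exists_succAbove_eq hk
    exact congrArg Subtype.val (DFunLike.congr_fun h j)
  · intro h
    ext1 j
    exact Subtype.ext (h _ (Fin.succAbove_ne i j))

theorem residue_initial_succAbove_succ {v : cs.Frame d} {c c' : C} {i : Fin (d + 1)} :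
    (B.residue (initial v.1 (i.succ.succAbove 0))).r c c' ↔ c = c' := by
  rw [Fin.succ_succAbove_zero, initial_zero, residue_empty_iff]

/-- In a pure nerve, a simplex of codimension one determines the rank of the missing set. -/
theorem eq_of_davisFace_eq (h : cs.nerve.IsPure d) {i i' : Fin (d + 2)}
    {x x' : B.DavisSimplex (d + 1)} (hx : B.davisFace i x = B.davisFace i' x') : i = i' := by
  obtain ⟨σ, ⟨c⟩⟩ := x
  obtain ⟨σ', ⟨c'⟩⟩ := x'
  have h1 := (davisSimplex_mk_eq_iff.1 hx).1
  refine Fin.succAbove_left_injective (funext fun j => Fin.ext ?_)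
  rw [← card_of_isPure h σ, ← card_of_isPure h σ']
  exact congrArg (fun t : Fin (d + 1) ↪o cs.Spherical => (t j).1.card) h1

/-- A chain of top dimension, as a function `α` of a frame and a chamber, is a cycle if it is
antisymmetric in the vertices of the frame, changes sign when the last vertex is replaced by the
other possible one, and has zero sum over the panels whose type is the first vertex. -/
structure FiniteThickness.IsFrameCycle (hB : B.FiniteThickness) (α : cs.Frame d → C → ℝ) :
    Prop where
  swap : ∀ (v : cs.Frame d) (j : Fin d) (c : C),
    α (v.perm (Equiv.swap j.castSucc j.succ)) c = -α v c
  last : ∀ (v v' : cs.Frame d) (c : C), v ≠ v' → v.AgreeOffLast v' → α v' c = -α v c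
  panel : ∀ (v : cs.Frame d) (c : C), ∑ x ∈ hB.panel (v.1 0) c, α v x = 0

section

variable [Finite S] (hB : B.FiniteThickness)

/-- The simplices whose `i`-th face is `y`. -/
def FiniteThickness.cofaces {k : ℕ} (i : Fin (k + 2)) (y : B.DavisSimplex k) :
    Finset (B.DavisSimplex (k + 1)) :=
  ((davisRealization hB).finite_cofaces i y).toFinset

theorem FiniteThickness.mem_cofaces {k : ℕ} {i : Fin (k + 2)} {y : B.DavisSimplex k}
    {x : B.DavisSimplex (k + 1)} : x ∈ hB.cofaces i y ↔ B.davisFace i x = y :=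
  Set.Finite.mem_toFinset _

theorem FiniteThickness.boundarySucc_apply {k : ℕ} (a : B.DavisSimplex (k + 1) → ℝ)
    (y : B.DavisSimplex k) : (davisRealization hB).boundarySucc k a y =
      ∑ i : Fin (k + 2), (-1) ^ (i : ℕ) * ∑ x ∈ hB.cofaces i y, a x :=
  rfl

theorem FiniteThickness.boundarySucc_davisFace (h : cs.nerve.IsPure d)
    (a : B.DavisSimplex (d + 1) → ℝ) (i : Fin (d + 2)) (x : B.DavisSimplex (d + 1)) :
    (davisRealization hB).boundarySucc d a (B.davisFace i x) = (-1) ^ (i : ℕ) *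
      ∑ y ∈ hB.cofaces i (B.davisFace i x), a y := by
  rw [hB.boundarySucc_apply]
  refine Finset.sum_eq_single i (fun i' _ hne => ?_) fun hi => absurd (Finset.mem_univ i) hi
  rw [Finset.sum_eq_zero, mul_zero]
  intro y hy
  exact absurd (eq_of_davisFace_eq h (hB.mem_cofaces.1 hy)) hne

theorem FiniteThickness.sum_cofaces_zero (h : cs.nerve.IsPure d)
    (a : B.DavisSimplex (d + 1) → ℝ) (v : cs.Frame d) (c : C) :
    ∑ y ∈ hB.cofaces 0 (B.davisFace 0 (B.frameSimplex v c)), a y =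
        ∑ x ∈ hB.panel (v.1 0) c, a (B.frameSimplex v x) := by
  symm
  refine Finset.sum_bij (fun x _ => B.frameSimplex v x) (fun x hx => ?_)
    (fun x _ y _ hxy => (frameSimplex_inj.1 hxy).2) (fun y hy => ?_) fun _ _ => rfl
  · refine hB.mem_cofaces.2 (davisFace_frameSimplex_eq_iff.2 ⟨fun _ _ => rfl, ?_⟩)
    rw [Fin.succAbove_zero, Fin.succ_zero_eq_one, initial_one, residue_singleton_iff]
    exact (B.rel _).symm (hB.mem_panel.1 hx)
  · obtain ⟨v', x, rfl⟩ := exists_frameSimplex_eq h y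
    obtain ⟨h1, h2⟩ := davisFace_frameSimplex_eq_iff.1 (hB.mem_cofaces.1 hy)
    obtain rfl : v' = v := Subtype.ext (forall_ne_zero_initial_eq_iff.1 h1)
    rw [Fin.succAbove_zero, Fin.succ_zero_eq_one, initial_one, residue_singleton_iff] at h2
    exact ⟨x, hB.mem_panel.2 ((B.rel _).symm h2), rfl⟩

theorem FiniteThickness.sum_cofaces_succ (h : cs.nerve.IsPure d)
    (a : B.DavisSimplex (d + 1) → ℝ) (j : Fin d) (v : cs.Frame d) (c : C) :
    ∑ y ∈ hB.cofaces j.castSucc.succ (B.davisFace j.castSucc.succ (B.frameSimplex v c)), a y =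
        a (B.frameSimplex v c) +
          a (B.frameSimplex (v.perm (Equiv.swap j.castSucc j.succ)) c) := by
  classical
  have hne : v ≠ v.perm (Equiv.swap j.castSucc j.succ) := by
    intro h
    have h1 := congrArg (fun u : cs.Frame d => u.1 j.castSucc) h
    simp only [Frame.perm_apply, Equiv.swap_apply_left] at h1
    exact Fin.castSucc_lt_succ.ne (v.1.injective h1)
  rw [← Finset.sum_pair (f := a) fun h => hne (frameSimplex_inj.1 h).1]
  refine Finset.sum_congr ?_ fun _ _ => rfl
  ext y
  obtain ⟨v', x, rfl⟩ := exists_frameSimplex_eq h y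
  rw [hB.mem_cofaces, Finset.mem_insert, Finset.mem_singleton, frameSimplex_inj,
    frameSimplex_inj]
  refine (eq_comm.trans davisFace_frameSimplex_eq_iff).trans ?_
  rw [residue_initial_succAbove_succ, forall_ne_initial_eq_iff, or_and_right]
  refine or_congr (and_congr ?_ eq_comm) (and_congr ?_ eq_comm)
  · exact ⟨fun h => (Subtype.ext h).symm, fun h => by rw [h]⟩
  · exact ⟨fun h => (Subtype.ext h).symm, fun h => by rw [h]; rfl⟩

theorem FiniteThickness.sum_cofaces_last (h : cs.nerve.IsPseudomanifold d)
    (a : B.DavisSimplex (d + 1) → ℝ) {v v' : cs.Frame d} (hne : v ≠ v')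
    (hv : v.AgreeOffLast v') (c : C) :
    ∑ y ∈ hB.cofaces (Fin.last (d + 1)) (B.davisFace (Fin.last (d + 1)) (B.frameSimplex v c)), a y =
        a (B.frameSimplex v c) + a (B.frameSimplex v' c) := by
  classical
  rw [← Finset.sum_pair (f := a) fun h => hne (frameSimplex_inj.1 h).1]
  refine Finset.sum_congr ?_ fun _ _ => rfl
  ext y
  obtain ⟨u, x, rfl⟩ := exists_frameSimplex_eq h.1 y
  rw [hB.mem_cofaces, Finset.mem_insert, Finset.mem_singleton, frameSimplex_inj,
    frameSimplex_inj]
  refine (eq_comm.trans davisFace_frameSimplex_eq_iff).trans ?_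
  rw [← Fin.succ_last, residue_initial_succAbove_succ, Fin.succ_last,
    forall_ne_last_initial_eq_iff, ← or_and_right]
  refine and_congr ⟨fun hu => ?_, ?_⟩ eq_comm
  · by_cases hvu : v = u
    · exact Or.inl hvu.symm
    · exact Or.inr (eq_of_agreeOffLast h hu hv hvu hne)
  · rintro (rfl | rfl)
    · exact fun _ _ => rfl
    · exact hv

/-- A chain of top dimension is a cycle exactly if the corresponding function of frames and
chambers is one. -/
theorem FiniteThickness.boundarySucc_eq_zero_iff (h : cs.nerve.IsPseudomanifold d)
    (a : B.DavisSimplex (d + 1) → ℝ) :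
    (davisRealization hB).boundarySucc d a = 0 ↔
      hB.IsFrameCycle fun (v : cs.Frame d) c => a (B.frameSimplex v c) := by
  constructor
  · intro ha
    have key : ∀ (i : Fin (d + 2)) (v : cs.Frame d) (c : C),
        ∑ y ∈ hB.cofaces i (B.davisFace i (B.frameSimplex v c)), a y = 0 := by
      intro i v c
      have h1 := hB.boundarySucc_davisFace h.1 a i (B.frameSimplex v c)
      rw [ha] at h1
      exact (mul_eq_zero.1 h1.symm).resolve_left (pow_ne_zero _ (by norm_num))
    refine ⟨fun v j c => ?_, fun v v' c hne hv => ?_, fun v c => ?_⟩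
    · have := key j.castSucc.succ v c
      rw [hB.sum_cofaces_succ h.1] at this
      linarith
    · have := key (Fin.last _) v c
      rw [hB.sum_cofaces_last h a hne hv] at this
      linarith
    · have := key 0 v c
      rwa [hB.sum_cofaces_zero h.1] at this
  · intro ha
    funext y
    by_cases hy : ∃ (i : Fin (d + 2)) (x : B.DavisSimplex (d + 1)), B.davisFace i x = y
    · obtain ⟨i, x, rfl⟩ := hy
      obtain ⟨v, c, rfl⟩ := exists_frameSimplex_eq h.1 x
      refine (hB.boundarySucc_davisFace h.1 a i _).trans (mul_eq_zero_of_right _ ?_)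
      induction i using Fin.cases with
      | zero => exact (hB.sum_cofaces_zero h.1 a v c).trans (ha.panel v c)
      | succ i =>
        induction i using Fin.lastCases with
        | last =>
          obtain ⟨v', hne, hv⟩ := exists_other_agreeOffLast h v
          refine (hB.sum_cofaces_last h a hne hv c).trans ?_
          have := ha.last v v' c hne hv
          linarith
        | cast j =>
          refine (hB.sum_cofaces_succ h.1 a j v c).trans ?_
          have := ha.swap v j c
          linarith
    · refine (hB.boundarySucc_apply a y).trans (Finset.sum_eq_zero fun i _ => ?_)
      rw [Finset.sum_eq_zero, mul_zero]
      intro x hx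
      exact absurd ⟨i, x, hB.mem_cofaces.1 hx⟩ hy

end

end Building

/-! ### The fundamental cycle of the Davis chamber -/

namespace CoxeterSystem

variable {S : Type u} {W : Type v} [Group W] {M : CoxeterMatrix S} {cs : CoxeterSystem M W}
  {d : ℕ}

theorem Frame.exists_perm_eq {v v' : cs.Frame d}
    (h : Finset.univ.map v.1 = Finset.univ.map v'.1) : ∃ π, v.perm π = v' := by
  have h1 : ∀ j, ∃ k, v.1 k = v'.1 j := fun j => by
    have : v'.1 j ∈ Finset.univ.map v.1 := by rw [h]; simp
    obtain ⟨k, -, hk⟩ := Finset.mem_map.1 this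
    exact ⟨k, hk⟩
  choose g hg using h1
  have hinj : Function.Injective g := fun i j hij =>
    v'.1.injective (by rw [← hg, ← hg, hij])
  refine ⟨Equiv.ofBijective g (Finite.injective_iff_bijective.1 hinj), ?_⟩
  exact Subtype.ext (Function.Embedding.ext hg)

theorem Frame.exists_map_eq_apply_eq {F : Finset S} (hF : F ∈ cs.nerve.facets d) {a : S}
    (ha : a ∈ F) (k : Fin (d + 1)) :
    ∃ v : cs.Frame d, Finset.univ.map v.1 = F ∧ v.1 k = a := by
  obtain ⟨v, hv⟩ := exists_frame_map_eq hF.1.2 hF.2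
  rw [← hv] at ha
  obtain ⟨j, -, rfl⟩ := Finset.mem_map.1 ha
  refine ⟨v.perm (Equiv.swap j k), by rw [v.map_perm, hv], ?_⟩
  rw [v.perm_apply, Equiv.swap_apply_right]

/-- An equivalence relation between frames which contains the transpositions of adjacent vertices
and the changes of the last vertex relates all frames, if the nerve is gallery connected. -/
theorem Frame.rel_of_isGalleryConnected (h : cs.nerve.IsPure d)
    (hgal : cs.nerve.IsGalleryConnected d) {R : cs.Frame d → cs.Frame d → Prop}
    (hR : Equivalence R)
    (swap : ∀ (v : cs.Frame d) (j : Fin d), R v (v.perm (Equiv.swap j.castSucc j.succ)))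
    (last : ∀ v v' : cs.Frame d, v.AgreeOffLast v' → R v v') (v v' : cs.Frame d) : R v v' := by
  have hperm : ∀ (π : Equiv.Perm (Fin (d + 1))) (v : cs.Frame d), R v (v.perm π) := by
    intro π
    have hπ : π ∈ Submonoid.closure
        (Set.range fun j : Fin d => Equiv.swap j.castSucc j.succ) := by
      rw [Equiv.Perm.mclosure_swap_castSucc_succ]
      trivial
    induction hπ using Submonoid.closure_induction with
    | mem x hx =>
      obtain ⟨j, rfl⟩ := hx
      exact fun v => swap v j
    | one => exact fun v => hR.refl v
    | mul x y _ _ hx hy => exact fun v => hR.trans (hx v) (hy (v.perm x))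
  have hmap : ∀ v v' : cs.Frame d, Finset.univ.map v.1 = Finset.univ.map v'.1 → R v v' := by
    intro v v' h
    obtain ⟨π, rfl⟩ := Frame.exists_perm_eq h
    exact hperm π v
  classical
  have key : ∀ F, Relation.ReflTransGen (fun α β : Finset S => α ∈ cs.nerve.facets d ∧
      β ∈ cs.nerve.facets d ∧ ∃ τ, τ ⊆ α ∧ τ ⊆ β ∧ τ.card = d) (Finset.univ.map v.1) F →
      ∀ u : cs.Frame d, Finset.univ.map u.1 = F → R v u := by
    intro F hF
    induction hF with
    | refl => exact fun u hu => hmap v u hu.symm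
    | tail _ hstep ih =>
      obtain ⟨hα, hβ, τ, hτα, hτβ, hτ⟩ := hstep
      intro u hu
      obtain ⟨a, haα, haτ⟩ : ∃ a ∈ _, a ∉ τ := Finset.exists_mem_notMem_of_card_lt_card
        (show τ.card < _ from by rw [hα.2, hτ]; exact Nat.lt_succ_self d)
      obtain ⟨x, hx, hxa⟩ := Frame.exists_map_eq_apply_eq hα haα (Fin.last d)
      have hini : initial x.1 (Fin.last d).castSucc = τ := by
        rw [initial_castSucc_last_eq_erase, hx, hxa]
        refine (Finset.eq_of_subset_of_card_le (t := Finset.erase _ a)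
          (fun b hb => Finset.mem_erase.2 ⟨fun h => haτ (h ▸ hb), hτα hb⟩) ?_).symm
        rw [Finset.card_erase_of_mem haα, hα.2, hτ]
        rfl
      obtain ⟨y, hxy, hy⟩ := x.exists_agreeOffLast h hβ (by rw [hini]; exact hτβ)
      exact hR.trans (ih x hx) (hR.trans (last x y hxy) (hmap y u (hy.trans hu.symm)))
  exact key _ (hgal _ v.map_mem_facets _ v'.map_mem_facets) v' rfl

/-- The orientation of the top-dimensional simplex of the Davis chamber given by a frame: the sign
of the Vandermonde determinant compares the order of the frame with the reference order `f` of the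
vertices, and `ε` is the orientation of the facet of the nerve. The entries are `-f`, so that the
last vertex contributes one sign for each vertex below it, as in the incidence numbers of the
nerve. -/
def Frame.sign (f : S → ℕ) (ε : Finset S → ℤˣ) (v : cs.Frame d) : ℤ :=
  (SignType.sign (Matrix.vandermonde fun j => -(f (v.1 j) : ℤ)).det : ℤ) *
    (ε (Finset.univ.map v.1) : ℤ)

theorem Frame.abs_sign {f : S → ℕ} (hf : Function.Injective f) (ε : Finset S → ℤˣ)
    (v : cs.Frame d) : |v.sign f ε| = 1 := by
  have h1 : (Matrix.vandermonde fun j => -(f (v.1 j) : ℤ)).det ≠ 0 := by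
    rw [Matrix.det_vandermonde_ne_zero_iff]
    intro i j hij
    exact v.1.injective (hf (by simpa using hij))
  rw [Frame.sign, abs_mul]
  have h2 : |(ε (Finset.univ.map v.1) : ℤ)| = 1 := Int.isUnit_iff_abs_eq.1 (Units.isUnit _)
  rw [h2, mul_one]
  rcases lt_or_gt_of_ne h1 with h | h
  · rw [sign_neg h]; simp
  · rw [sign_pos h]; simp

theorem Frame.sign_swap (f : S → ℕ) (ε : Finset S → ℤˣ) (v : cs.Frame d) (j : Fin d) :
    (v.perm (Equiv.swap j.castSucc j.succ)).sign f ε = -v.sign f ε := by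
  have h1 : (Matrix.vandermonde fun i =>
      -(f ((v.perm (Equiv.swap j.castSucc j.succ)).1 i) : ℤ)) =
      (Matrix.vandermonde fun i => -(f (v.1 i) : ℤ)).submatrix
        (Equiv.swap j.castSucc j.succ) id := rfl
  rw [Frame.sign, Frame.sign, v.map_perm, h1, Matrix.det_permute,
    Equiv.Perm.sign_swap Fin.castSucc_lt_succ.ne]
  simp [Left.sign_neg]

/-- The contribution of the last vertex `b` to the sign of the Vandermonde determinant is
`(-1) ^ m`, where `m` is the number of the other vertices below `b`. -/
theorem sign_vandermonde_eq (f : S → ℕ) (hf : Function.Injective f) (v : Fin (d + 1) ↪ S) :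
    SignType.sign (Matrix.vandermonde fun j => -(f (v j) : ℤ)).det =
      (∏ j : Fin d, ∏ i ∈ Finset.univ.filter (· < j.castSucc),
        SignType.sign (-(f (v j.castSucc) : ℤ) - -(f (v i) : ℤ))) *
      (-1) ^ ((initial v (Fin.last d).castSucc).filter
        fun u => f u < f (v (Fin.last d))).card := by
  have h1 : (Matrix.vandermonde fun j => -(f (v j) : ℤ)).det =
      ∏ j, ∏ i ∈ Finset.univ.filter (· < j), (-(f (v j) : ℤ) - -(f (v i) : ℤ)) := by
    rw [Matrix.det_vandermonde]
    exact Finset.prod_comm' fun i j => by simp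
  have hsign : ∀ z : ℤ, SignType.sign z = signHom z := fun _ => rfl
  have hini : initial v (Fin.last d).castSucc =
      (Finset.univ.filter (· < Fin.last d)).map v := by
    simp [initial, Fin.castSucc_lt_castSucc_iff]
  rw [h1, Fin.prod_univ_castSucc, hsign, map_mul, map_prod, hini]
  congr 1
  · exact Finset.prod_congr rfl fun j _ => map_prod _ _ _
  · rw [map_prod, Finset.filter_map, Finset.card_map]
    rw [← Finset.prod_const]
    refine Eq.trans ?_ (Finset.prod_filter _ _).symm
    refine Finset.prod_congr rfl fun i hi => ?_
    have hne : f (v i) ≠ f (v (Fin.last d)) := fun h =>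
      (Finset.mem_filter.1 hi).2.ne (v.injective (hf h))
    rw [← hsign]
    simp only [Function.comp_apply]
    split_ifs with h
    · exact sign_neg (by omega)
    · exact sign_pos (by omega)

theorem Frame.map_eq_insert [DecidableEq S] (v : cs.Frame d) :
    Finset.univ.map v.1 = insert (v.1 (Fin.last d)) (initial v.1 (Fin.last d).castSucc) := by
  rw [initial_castSucc_last_eq_erase, Finset.insert_erase]
  simp

theorem Frame.last_notMem (v : cs.Frame d) :
    v.1 (Fin.last d) ∉ initial v.1 (Fin.last d).castSucc := by
  rw [apply_mem_initial]
  exact lt_irrefl _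

open Classical in
theorem Frame.sign_last [Fintype S] (h : cs.nerve.IsPseudomanifold d) {f : S → ℕ}
    (hf : Function.Injective f) {ε : Finset S → ℤˣ}
    (hε : ∀ τ ∈ cs.nerve.ridges d, ∑ v with v ∉ τ ∧ insert v τ ∈ cs.nerve,
      (-1 : ℤ) ^ (τ.filter fun u => f u < f v).card * (ε (insert v τ) : ℤ) = 0)
    {v v' : cs.Frame d} (hne : v ≠ v') (hv : v.AgreeOffLast v') :
    v'.sign f ε = -v.sign f ε := by
  set τ := initial v.1 (Fin.last d).castSucc with hτ
  have hτ' : initial v'.1 (Fin.last d).castSucc = τ := hv.initial_eq.symm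
  have hab : v.1 (Fin.last d) ≠ v'.1 (Fin.last d) := fun hab =>
    hne (hv.eq_of_map_eq (by rw [v.map_eq_insert, v'.map_eq_insert, hτ', hab]))
  have hset : (Finset.univ.filter fun b => b ∉ τ ∧ insert b τ ∈ cs.nerve) =
      {v.1 (Fin.last d), v'.1 (Fin.last d)} := by
    ext b
    simp only [Finset.mem_filter, Finset.mem_univ, true_and, Finset.mem_insert,
      Finset.mem_singleton]
    constructor
    · rintro ⟨hb, hbK⟩
      have hF : insert b τ ∈ cs.nerve.facets d := by
        refine ⟨hbK, ?_⟩
        rw [Finset.card_insert_of_notMem hb, hτ, v.card_initial h.1]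
        rfl
      obtain ⟨u, hu, humap⟩ := v.exists_agreeOffLast h.1 hF (Finset.subset_insert _ _)
      have hub : u.1 (Fin.last d) = b := by
        have h1 : u.1 (Fin.last d) ∈ insert b τ := by rw [← humap]; simp
        refine (Finset.mem_insert.1 h1).resolve_right fun h2 => u.last_notMem ?_
        rwa [← hu.initial_eq]
      by_cases hvu : v = u
      · left; rw [hvu, hub]
      · right; rw [← eq_of_agreeOffLast h hu hv hvu hne, hub]
    · rintro (rfl | rfl)
      · exact ⟨v.last_notMem, by rw [hτ, ← v.map_eq_insert]; exact v.map_mem_facets.1⟩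
      · exact ⟨hτ' ▸ v'.last_notMem, by
          rw [← hτ', ← v'.map_eq_insert]; exact v'.map_mem_facets.1⟩
  have h1 := hε τ (v.initial_mem_ridges h.1)
  rw [hset, Finset.sum_pair hab, hτ, ← v.map_eq_insert, ← hτ, ← hτ', ← v'.map_eq_insert] at h1
  rw [Frame.sign, Frame.sign, sign_vandermonde_eq f hf, sign_vandermonde_eq f hf]
  have hrest : (∏ j : Fin d, ∏ i ∈ Finset.univ.filter (· < j.castSucc),
        SignType.sign (-(f (v'.1 j.castSucc) : ℤ) - -(f (v'.1 i) : ℤ))) =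
      ∏ j : Fin d, ∏ i ∈ Finset.univ.filter (· < j.castSucc),
        SignType.sign (-(f (v.1 j.castSucc) : ℤ) - -(f (v.1 i) : ℤ)) := by
    refine Finset.prod_congr rfl fun j _ => Finset.prod_congr rfl fun i hi => ?_
    rw [hv _ (Fin.castSucc_lt_last j).ne,
      hv i ((Finset.mem_filter.1 hi).2.trans (Fin.castSucc_lt_last j)).ne]
  rw [hrest, hv.initial_eq]
  push_cast
  simp only [SignType.coe_one]
  linear_combination (SignType.cast (∏ j : Fin d, ∏ i ∈ Finset.univ.filter (· < j.castSucc),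
        SignType.sign (-(f (v.1 j.castSucc) : ℤ) - -(f (v.1 i) : ℤ))) : ℤ) * h1

end CoxeterSystem

namespace Building

variable {S : Type u} {W : Type v} [Group W] {M : CoxeterMatrix S} {cs : CoxeterSystem M W}
  {C : Type w} {B : Building cs C} {d : ℕ}

open CoxeterSystem

/-- The restrictions of a cycle to the simplices of two frames agree up to a sign which is the same
for all chambers. -/
theorem FiniteThickness.IsFrameCycle.eq_or_eq_neg {hB : B.FiniteThickness}
    {α : cs.Frame d → C → ℝ} (hα : hB.IsFrameCycle α) (h : cs.nerve.IsPure d)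
    (hgal : cs.nerve.IsGalleryConnected d) (v v' : cs.Frame d) :
    α v' = α v ∨ α v' = -α v := by
  refine Frame.rel_of_isGalleryConnected h hgal (R := fun v v' => α v' = α v ∨ α v' = -α v)
    ⟨fun _ => Or.inl rfl, ?_, ?_⟩ ?_ ?_ v v'
  · rintro x y (hxy | hxy)
    · exact Or.inl hxy.symm
    · exact Or.inr (by rw [hxy, neg_neg])
  · rintro x y z (hxy | hxy) (hyz | hyz)
    · exact Or.inl (hyz.trans hxy)
    · exact Or.inr (by rw [hyz, hxy])
    · exact Or.inr (by rw [hyz, hxy])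
    · exact Or.inl (by rw [hyz, hxy, neg_neg])
  · exact fun v j => Or.inr (funext fun c => hα.swap v j c)
  · intro x y hxy
    by_cases hne : x = y
    · exact Or.inl (by rw [hne])
    · exact Or.inr (funext fun c => hα.last x y c hne hxy)

theorem FiniteThickness.IsFrameCycle.isAlternating {hB : B.FiniteThickness}
    {α : cs.Frame d → C → ℝ} (hα : hB.IsFrameCycle α) (h : cs.nerve.IsPure d)
    (hgal : cs.nerve.IsGalleryConnected d) (v : cs.Frame d) : hB.IsAlternating (α v) := by
  intro s c
  obtain ⟨F, hF, hs, hcard, -⟩ := h {s} ⟨⟨s, by simp⟩, cs.isSpherical_singleton s⟩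
  obtain ⟨u, -, rfl⟩ := Frame.exists_map_eq_apply_eq ⟨hF, hcard⟩
    (Finset.singleton_subset_iff.1 hs) 0
  rcases hα.eq_or_eq_neg h hgal u v with huv | huv
  · rw [huv]; exact hα.panel u c
  · rw [huv]
    simp only [Pi.neg_apply, Finset.sum_neg_distrib, hα.panel u c, neg_zero]

/-- A function summing to zero over panels, times the orientation of the simplices of the Davis
chamber, is a cycle. -/
theorem FiniteThickness.IsAlternating.isFrameCycle {hB : B.FiniteThickness} {φ : C → ℝ}
    (hφ : hB.IsAlternating φ) {f : S → ℕ}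
    {ε : Finset S → ℤˣ} (hsign : ∀ v v' : cs.Frame d, v ≠ v' → v.AgreeOffLast v' →
      v'.sign f ε = -v.sign f ε) :
    hB.IsFrameCycle fun (v : cs.Frame d) c => (v.sign f ε : ℝ) * φ c := by
  refine ⟨fun v j c => ?_, fun v v' c hne hv => ?_, fun v c => ?_⟩
  · rw [v.sign_swap]; push_cast; ring
  · rw [hsign v v' hne hv]; push_cast; ring
  · rw [← Finset.mul_sum, hφ, mul_zero]

end Building

/-! ### Duality between `ℓ^p`-cohomology and `ℓ^q`-homology in top dimension -/

namespace OrderedComplex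

variable (X : OrderedComplex.{u}) {k : ℕ}

theorem nontrivial_lpHomology_iff [IsEmpty (X.simplex (k + 2))] (p : ℝ≥0∞) [Fact (1 ≤ p)] :
    Nontrivial (X.LpHomology p (k + 1)) ↔ X.lpCycles p (k + 1) ≠ ⊥ := by
  have hbot : X.lpBoundaries p (k + 1) = ⊥ := by
    rw [eq_bot_iff]
    rintro a ⟨b, hb⟩
    rw [Subsingleton.elim b 0, map_zero] at hb
    exact lp.ext hb.symm
  rw [Submodule.Quotient.nontrivial_iff, hbot, Ne, Submodule.submoduleOf_eq_top, le_bot_iff]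

theorem nontrivial_reducedLpCohomology_iff [IsEmpty (X.simplex (k + 2))] (p : ℝ≥0∞)
    [Fact (1 ≤ p)] : Nontrivial (X.ReducedLpCohomology p (k + 1)) ↔
      (X.lpCoboundaries p (k + 1)).topologicalClosure ≠ ⊤ := by
  have htop : X.lpCocycles p (k + 1) = ⊤ := by
    rw [eq_top_iff]
    intro a _
    exact funext fun x => isEmptyElim x
  rw [Submodule.Quotient.nontrivial_iff, Ne, Submodule.submoduleOf_eq_top, htop, top_le_iff]

/-- Composition with a map whose fibres have at most `N` elements preserves `p`-summability. -/
theorem memℓp_comp_of_card_fiber_le {ι κ : Type*} [DecidableEq κ] {p : ℝ≥0∞} (hp : 0 < p.toReal)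
    (g : ι → κ) {N : ℕ} (hN : ∀ (s : Finset ι) (y : κ), (s.filter fun x => g x = y).card ≤ N)
    (f : lp (fun _ : κ => ℝ) p) : Memℓp (fun x => f (g x)) p := by
  refine memℓp_gen' (C := N * ∑' y, ‖f y‖ ^ p.toReal) fun s => ?_
  have hs := (lp.memℓp f).summable hp
  rw [Finset.sum_comp (fun y => ‖f y‖ ^ p.toReal) g]
  refine (Finset.sum_le_sum (g := fun y => (N : ℝ) * ‖f y‖ ^ p.toReal) fun y _ => ?_).trans ?_
  · rw [nsmul_eq_mul]
    exact mul_le_mul_of_nonneg_right (by exact_mod_cast hN s y)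
      (Real.rpow_nonneg (norm_nonneg _) _)
  · rw [← Finset.mul_sum]
    exact mul_le_mul_of_nonneg_left
      (hs.sum_le_tsum _ fun y _ => Real.rpow_nonneg (norm_nonneg _) _) (Nat.cast_nonneg _)

/-- A continuous functional on `ℓ^p` is given by a `q`-summable family: this is the converse of
Hölder's inequality. -/
theorem memℓp_dual {ι : Type*} [DecidableEq ι] {p q : ℝ≥0∞} [Fact (1 ≤ p)]
    (hpq : p.toReal.HolderConjugate q.toReal) (f : lp (fun _ : ι => ℝ) p →L[ℝ] ℝ) :
    Memℓp (fun x => f (lp.single p x (1 : ℝ))) q := by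
  set b : ι → ℝ := fun x => f (lp.single p x (1 : ℝ)) with hb
  have hp := hpq.pos
  have hq := hpq.symm.pos
  refine memℓp_gen' (C := ‖f‖ ^ q.toReal) fun s => ?_
  set A : ℝ := ∑ x ∈ s, ‖b x‖ ^ q.toReal with hA
  have hA0 : 0 ≤ A := Finset.sum_nonneg fun x _ => Real.rpow_nonneg (norm_nonneg _) _
  -- test `f` on the element on which Hölder's inequality is an equality
  let g : ι → ℝ := fun x => (SignType.sign (b x) : ℝ) * ‖b x‖ ^ (q.toReal - 1)
  have hsingle : ∀ x (r : ℝ), f (lp.single p x r) = r * b x := fun x r => by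
    have : lp.single (E := fun _ : ι => ℝ) p x r = r • lp.single p x (1 : ℝ) := by
      rw [← lp.single_smul, smul_eq_mul, mul_one]
    rw [this, map_smul, smul_eq_mul]
  have hf : f (∑ x ∈ s, lp.single p x (g x)) = A := by
    rw [map_sum]
    refine Finset.sum_congr rfl fun x _ => ?_
    rw [hsingle]
    by_cases h0 : b x = 0
    · simp [h0, Real.zero_rpow hq.ne']
    · have h1 : 0 < ‖b x‖ := norm_pos_iff.2 h0
      have h2 : (SignType.sign (b x) : ℝ) * b x = ‖b x‖ := by
        rw [mul_comm, self_mul_sign]; rfl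
      calc g x * b x = ((SignType.sign (b x) : ℝ) * b x) * ‖b x‖ ^ (q.toReal - 1) := by
            simp only [g]; ring
        _ = ‖b x‖ ^ q.toReal := by
            rw [h2, Real.rpow_sub h1, Real.rpow_one]
            field_simp
  have hnorm : ‖∑ x ∈ s, lp.single (E := fun _ : ι => ℝ) p x (g x)‖ ^ p.toReal ≤ A := by
    rw [lp.norm_sum_single hp]
    refine Finset.sum_le_sum fun x _ => ?_
    have h1 : ‖g x‖ ≤ ‖b x‖ ^ (q.toReal - 1) := by
      simp only [g]
      rw [norm_mul, Real.norm_of_nonneg (Real.rpow_nonneg (norm_nonneg (b x)) _)]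
      refine mul_le_of_le_one_left (Real.rpow_nonneg (norm_nonneg _) _) ?_
      rcases lt_trichotomy (b x) 0 with h | h | h <;> simp [h]
    refine (Real.rpow_le_rpow (norm_nonneg _) h1 hp.le).trans_eq ?_
    rw [← Real.rpow_mul (norm_nonneg _), hpq.symm.sub_one_mul_conj]
  have hle : A ≤ ‖f‖ * A ^ (1 / p.toReal) := by
    rw [← hf]
    refine (le_abs_self _).trans ((f.le_opNorm _).trans ?_)
    rw [hf]
    refine mul_le_mul_of_nonneg_left ?_ (norm_nonneg _)
    rwa [one_div, Real.le_rpow_inv_iff_of_pos (norm_nonneg _) hA0 hp]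
  rcases hA0.eq_or_lt with h0 | h0
  · rw [← h0]; positivity
  · have h1 : A ^ (1 / q.toReal) ≤ ‖f‖ := by
      have h2 : A = A ^ (1 / q.toReal) * A ^ (1 / p.toReal) := by
        rw [← Real.rpow_add h0, add_comm, one_div, one_div, hpq.inv_add_inv_eq_one, Real.rpow_one]
      refine le_of_mul_le_mul_right ?_ (Real.rpow_pos_of_pos h0 (1 / p.toReal))
      rwa [← h2]
    calc A = (A ^ (1 / q.toReal)) ^ q.toReal := by
          rw [← Real.rpow_mul hA0, one_div_mul_cancel hq.ne', Real.rpow_one]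
      _ ≤ ‖f‖ ^ q.toReal := Real.rpow_le_rpow (Real.rpow_nonneg hA0 _) h1 hq.le

theorem hasSum_fiberwise_cofaces (i : Fin (k + 2)) {F : X.simplex (k + 1) → ℝ} {r : ℝ}
    (hF : HasSum F r) :
    HasSum (fun y => ∑ x ∈ (X.finite_cofaces i y).toFinset, F x) r := by
  have key : (fun y => ∑ x ∈ (X.finite_cofaces i y).toFinset, F x) =
      fun y => ∑' x : X.face i ⁻¹' {y}, F x := by
    funext y
    rw [← Finset.tsum_subtype', Set.Finite.coe_toFinset]
    rfl
  rw [key]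
  exact hF.tsum_fiberwise (X.face i)

/-- The boundary is adjoint to the coboundary, if the number of cofaces is bounded. -/
theorem hasSum_coboundary_mul {p q : ℝ≥0∞} (hpq : p.toReal.HolderConjugate q.toReal) {N : ℕ}
    (hN : ∀ (i : Fin (k + 2)) (y : X.simplex k), (X.finite_cofaces i y).toFinset.card ≤ N)
    (ω : lp (fun _ : X.simplex k => ℝ) p) (b : lp (fun _ : X.simplex (k + 1) => ℝ) q) :
    ∃ r : ℝ, HasSum (fun x => X.coboundary k ω x * b x) r ∧
      HasSum (fun y => ω y * X.boundarySucc k b y) r := by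
  classical
  have hmem : ∀ i : Fin (k + 2), Memℓp (fun x => ω (X.face i x)) p := fun i =>
    memℓp_comp_of_card_fiber_le hpq.pos (X.face i) (fun s y =>
      (Finset.card_le_card fun x hx => by
        rw [Set.Finite.mem_toFinset]
        exact (Finset.mem_filter.1 hx).2).trans (hN i y)) ω
  have hsum : ∀ i : Fin (k + 2), Summable fun x => ω (X.face i x) * b x := fun i => by
    refine Summable.of_norm ?_
    simp_rw [norm_mul]
    exact lp.summable_mul hpq (⟨_, hmem i⟩ : lp (fun _ : X.simplex (k + 1) => ℝ) p) b
  refine ⟨∑ i : Fin (k + 2), (-1) ^ (i : ℕ) * ∑' x, ω (X.face i x) * b x, ?_, ?_⟩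
  · have := hasSum_sum (s := Finset.univ) fun (i : Fin (k + 2)) _ =>
      (hsum i).hasSum.mul_left ((-1) ^ (i : ℕ))
    have hfun : (fun x => X.coboundary k ω x * b x) = fun x => ∑ i : Fin (k + 2),
        (-1) ^ (i : ℕ) * (ω (X.face i x) * b x) := by
      funext x
      rw [coboundary, LinearMap.coe_mk, AddHom.coe_mk, Finset.sum_mul]
      exact Finset.sum_congr rfl fun i _ => by ring
    rw [hfun]
    exact this
  · have := hasSum_sum (s := Finset.univ) fun (i : Fin (k + 2)) _ =>
      (X.hasSum_fiberwise_cofaces i (hsum i).hasSum).mul_left ((-1) ^ (i : ℕ))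
    have hfun : (fun y => ω y * X.boundarySucc k b y) = fun y => ∑ i : Fin (k + 2),
        (-1) ^ (i : ℕ) * ∑ x ∈ (X.finite_cofaces i y).toFinset, ω (X.face i x) * b x := by
      funext y
      rw [boundarySucc, LinearMap.coe_mk, AddHom.coe_mk, Finset.mul_sum]
      refine Finset.sum_congr rfl fun i _ => ?_
      rw [Finset.mul_sum, Finset.mul_sum, Finset.mul_sum]
      refine Finset.sum_congr rfl fun x hx => ?_
      rw [(Set.Finite.mem_toFinset _).1 hx]
      ring
    rw [hfun]
    exact this

/-- The reduced `ℓ^p`-cohomology in the top dimension is dual to the `ℓ^q`-homology: the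
annihilator of the coboundaries consists of the cycles. -/
theorem topologicalClosure_lpCoboundaries_ne_top_iff {p q : ℝ≥0∞} [Fact (1 ≤ p)] [Fact (1 ≤ q)]
    (hpq : p.toReal.HolderConjugate q.toReal) {N : ℕ}
    (hN : ∀ (i : Fin (k + 2)) (y : X.simplex k), (X.finite_cofaces i y).toFinset.card ≤ N) :
    (X.lpCoboundaries p (k + 1)).topologicalClosure ≠ ⊤ ↔ X.lpCycles q (k + 1) ≠ ⊥ := by
  classical
  have hptop : p ≠ ⊤ := by
    rintro rfl
    simpa using hpq.pos
  constructor
  · intro h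
    obtain ⟨x, hx⟩ : ∃ x, x ∉ (X.lpCoboundaries p (k + 1)).topologicalClosure := by
      by_contra! hcon
      exact h (eq_top_iff.2 fun x _ => hcon x)
    obtain ⟨f, r, hf, hfx⟩ := geometric_hahn_banach_closed_point
      (X.lpCoboundaries p (k + 1)).topologicalClosure.convex
      (X.lpCoboundaries p (k + 1)).isClosed_topologicalClosure hx
    -- a functional bounded above on a subspace vanishes on it
    have hf0 : ∀ a ∈ X.lpCoboundaries p (k + 1), f a = 0 := by
      intro a ha
      by_contra hne
      have := hf ((f x / f a) • a)
        (Submodule.smul_mem _ _ (Submodule.le_topologicalClosure _ ha))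
      rw [map_smul, smul_eq_mul, div_mul_cancel₀ _ hne] at this
      exact lt_asymm this hfx
    have hfne : f ≠ 0 := by
      rintro rfl
      have := hf 0 (Submodule.zero_mem _)
      simp only [map_zero, zero_apply] at this hfx
      exact lt_asymm this hfx
    let b : X.lpChain q (k + 1) := ⟨_, memℓp_dual hpq f⟩
    have hb : ∀ x, b x = f (lp.single p x (1 : ℝ)) := fun _ => rfl
    refine (Submodule.ne_bot_iff _).2 ⟨b, ?_, fun hb0 => hfne ?_⟩
    -- the coefficient of `∂ b` at `y` is the value of `f` at the coboundary of `y`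
    · refine funext fun y => ?_
      have hmem : (∑ i : Fin (k + 2), (-1 : ℝ) ^ (i : ℕ) •
          ∑ x ∈ (X.finite_cofaces i y).toFinset, lp.single p x (1 : ℝ) : X.lpChain p (k + 1)) ∈
          X.lpCoboundaries p (k + 1) := by
        refine ⟨lp.single p y (1 : ℝ), funext fun x => ?_⟩
        change X.coboundary k (lp.single p y (1 : ℝ)) x = (∑ i : Fin (k + 2), (-1 : ℝ) ^ (i : ℕ) •
          ∑ x ∈ (X.finite_cofaces i y).toFinset, lp.single p x (1 : ℝ) : X.lpChain p (k + 1)) x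
        rw [coboundary, LinearMap.coe_mk, AddHom.coe_mk, lp.coeFn_sum, Finset.sum_apply]
        refine Finset.sum_congr rfl fun i _ => ?_
        rw [lp.coeFn_smul, Pi.smul_apply, smul_eq_mul, lp.coeFn_sum, Finset.sum_apply]
        congr 1
        simp only [lp.single_apply, Pi.single_apply, Finset.sum_ite_eq, Set.Finite.mem_toFinset]
        rfl
      have h1 := hf0 _ hmem
      rw [map_sum] at h1
      simp only [map_smul, map_sum, smul_eq_mul] at h1
      exact h1
    · refine ContinuousLinearMap.ext fun a => ?_
      have h1 := (lp.hasSum_single hptop a).mapL f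
      have h2 : ∀ x, f (lp.single p x (a x)) = 0 := fun x => by
        have h3 : lp.single (E := fun _ : X.simplex (k + 1) => ℝ) p x (a x) =
            a x • lp.single p x (1 : ℝ) := by
          rw [← lp.single_smul, smul_eq_mul, mul_one]
        rw [h3, map_smul, ← hb, hb0]
        simp
      simp only [h2] at h1
      exact h1.unique hasSum_zero
  · intro h
    obtain ⟨b, hb, hb0⟩ := (Submodule.ne_bot_iff _).1 h
    have : p.HolderConjugate q := ENNReal.HolderConjugate.of_toReal hpq
    have hK : ∀ _ : X.simplex (k + 1), ‖ContinuousLinearMap.mul ℝ ℝ‖ ≤ ((1 : NNReal) : ℝ) :=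
      fun _ => by simp
    let f : X.lpChain p (k + 1) →L[ℝ] ℝ :=
      (lp.dualPairing p q (fun _ : X.simplex (k + 1) => ContinuousLinearMap.mul ℝ ℝ) hK).flip b
    have hf : ∀ a, f a = ∑' x, a x * b x := fun a => lp.dualPairing_apply _ hK a b
    have hle : (X.lpCoboundaries p (k + 1)).topologicalClosure ≤ LinearMap.ker f.toLinearMap := by
      refine Submodule.topologicalClosure_minimal _ ?_ f.isClosed_ker
      rintro a ⟨ω, hω⟩
      obtain ⟨r, h1, h2⟩ := X.hasSum_coboundary_mul hpq hN ω b
      have h3 : X.boundarySucc k b = 0 := hb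
      have h4 : X.coboundary k ω = a := hω
      rw [h4] at h1
      simp only [h3, Pi.zero_apply, mul_zero] at h2
      rw [LinearMap.mem_ker]
      refine (hf a).trans ?_
      rw [h1.tsum_eq]
      exact h2.unique hasSum_zero
    intro htop
    rw [htop, top_le_iff] at hle
    refine hb0 (lp.ext (funext fun x => ?_))
    have h1 : f (lp.single p x (1 : ℝ)) = 0 := by
      have : lp.single p x (1 : ℝ) ∈ LinearMap.ker f.toLinearMap := by rw [hle]; trivial
      exact this
    rw [hf, tsum_eq_single x fun y hy => by rw [lp.single_apply_ne _ _ _ hy, zero_mul]] at h1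
    simpa using h1

end OrderedComplex

/-! ### Nonvanishing in top dimension -/

namespace CoxeterSystem

variable {S : Type u} {W : Type v} [Group W] {M : CoxeterMatrix S} {cs : CoxeterSystem M W}
  {d : ℕ}

instance [Finite S] : Finite (cs.Frame d) := Subtype.finite

end CoxeterSystem

namespace Building

variable {S : Type u} {W : Type v} [Group W] {M : CoxeterMatrix S} {cs : CoxeterSystem M W}
  {C : Type w} {B : Building cs C} {d : ℕ}

open CoxeterSystem

theorem bijective_frameSimplex (h : cs.nerve.IsPure d) :
    Function.Bijective fun z : cs.Frame d × C => B.frameSimplex z.1 z.2 := by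
  refine ⟨fun z z' hz => ?_, fun x => ?_⟩
  · obtain ⟨h1, h2⟩ := frameSimplex_inj.1 hz
    exact Prod.ext h1 h2
  · obtain ⟨v, c, hx⟩ := exists_frameSimplex_eq h x
    exact ⟨(v, c), hx⟩

theorem isEmpty_davisSimplex (h : cs.nerve.IsPure d) : IsEmpty (B.DavisSimplex (d + 2)) :=
  ⟨fun x => by have := le_of_isPure h x.1; omega⟩

theorem eq_of_hasDim [Finite S] [Infinite W] [Nonempty C] (hB : B.FiniteThickness)
    (h : cs.nerve.IsPure d) {n : ℕ} (hn : (davisRealization hB).HasDim n) : n = d + 1 := by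
  refine le_antisymm ?_ (hn.2 ?_)
  · obtain ⟨x⟩ : Nonempty (B.DavisSimplex n) := hn.1
    exact le_of_isPure h x.1
  · obtain ⟨v⟩ := nonempty_frame (cs := cs) h
    obtain ⟨c⟩ := ‹Nonempty C›
    exact ⟨B.frameSimplex v c⟩

/-- The number of cofaces of top dimension is bounded by the largest panel size or by two. -/
theorem IsRegular.exists_card_cofaces_le [Finite S] {q : S → ℕ} (hB : B.IsRegular q)
    (h : cs.nerve.IsPseudomanifold d) : ∃ N : ℕ, ∀ (i : Fin (d + 2)) (y : B.DavisSimplex d),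
      (hB.finiteThickness.cofaces i y).card ≤ N := by
  obtain ⟨Q, hQ⟩ := Set.Finite.bddAbove (Set.finite_range q)
  refine ⟨Q + 2, fun i y => ?_⟩
  rcases (hB.finiteThickness.cofaces i y).eq_empty_or_nonempty with h0 | ⟨x, hx⟩
  · simp [h0]
  obtain ⟨v, c, rfl⟩ := exists_frameSimplex_eq h.1 x
  rw [← hB.finiteThickness.mem_cofaces.1 hx]
  suffices hle : ∑ y ∈ hB.finiteThickness.cofaces i (B.davisFace i (B.frameSimplex v c)),
      (1 : ℝ) ≤ (Q + 2 : ℕ) by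
    rw [Finset.sum_const, nsmul_eq_mul, mul_one] at hle
    exact_mod_cast hle
  induction i using Fin.cases with
  | zero =>
    rw [hB.finiteThickness.sum_cofaces_zero h.1 (fun _ => 1), Finset.sum_const, hB.card_panel,
      nsmul_eq_mul, mul_one]
    have : q (v.1 0) ≤ Q := hQ ⟨_, rfl⟩
    exact_mod_cast (by omega : q (v.1 0) + 1 ≤ Q + 2)
  | succ i =>
    have h2 : (1 : ℝ) + 1 ≤ (Q + 2 : ℕ) := by
      push_cast
      linarith [Q.cast_nonneg (α := ℝ)]
    induction i using Fin.lastCases with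
    | last =>
      obtain ⟨v', hne, hv⟩ := exists_other_agreeOffLast h v
      exact (hB.finiteThickness.sum_cofaces_last h (fun _ => 1) hne hv c).trans_le h2
    | cast j => exact (hB.finiteThickness.sum_cofaces_succ h.1 (fun _ => 1) j v c).trans_le h2

/-- There are nonzero `ℓ^p`-cycles of top dimension exactly if `∑ q_w ^ (1 - p)` converges. -/
theorem IsRegular.lpCycles_ne_bot_iff [Fintype S] [Infinite W] [Nonempty C] {q : S → ℕ}
    (hq : ∀ s, 2 ≤ q s) (hB : B.IsRegular q) (h : cs.nerve.IsPseudomanifold d)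
    (hor : cs.nerve.IsOrientable d) (hgal : cs.nerve.IsGalleryConnected d) {p : ℝ} (hp : 1 < p)
    [Fact (1 ≤ ENNReal.ofReal p)] :
    (davisRealization hB.finiteThickness).lpCycles (ENNReal.ofReal p) (d + 1) ≠ ⊥ ↔
      Summable fun w : W => (cs.weight q w : ℝ) ^ (-(p - 1)) := by
  have hpr : (ENNReal.ofReal p).toReal = p := ENNReal.toReal_ofReal (by linarith)
  have hp0 : 0 < (ENNReal.ofReal p).toReal := by rw [hpr]; linarith
  constructor
  · intro hne
    obtain ⟨a, ha, ha0⟩ := (Submodule.ne_bot_iff _).1 hne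
    have hcyc := (hB.finiteThickness.boundarySucc_eq_zero_iff h a).1 ha
    obtain ⟨x, hx⟩ : ∃ x : B.DavisSimplex (d + 1), a x ≠ 0 := by
      by_contra! hcon
      exact ha0 (lp.ext (funext hcon))
    obtain ⟨v, c, rfl⟩ := exists_frameSimplex_eq h.1 x
    refine hB.summable_weight_of_isAlternating hq hp (hcyc.isAlternating h.1 hgal v) ?_ hx
    have hsum := (lp.memℓp a).summable hp0
    rw [hpr] at hsum
    exact hsum.comp_injective (i := B.frameSimplex v) fun c c' hc => (frameSimplex_inj.1 hc).2
  · intro hsum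
    obtain ⟨f, hf, ε, hε⟩ := hor
    obtain ⟨c⟩ := ‹Nonempty C›
    obtain ⟨v⟩ := nonempty_frame h.1
    let φ := B.radial q c
    have hφ : hB.finiteThickness.IsAlternating φ := hB.isAlternating_radial hq c
    let e := Equiv.ofBijective _ (bijective_frameSimplex (B := B) h.1)
    let a : B.DavisSimplex (d + 1) → ℝ := fun x => ((e.symm x).1.sign f ε : ℝ) * φ (e.symm x).2
    have ha : ∀ v c, a (B.frameSimplex v c) = (v.sign f ε : ℝ) * φ c := fun v c => by
      have : e.symm (B.frameSimplex v c) = (v, c) := e.symm_apply_apply (v, c)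
      simp only [a, this]
    have hcyc : (davisRealization hB.finiteThickness).boundarySucc d a = 0 := by
      rw [hB.finiteThickness.boundarySucc_eq_zero_iff h]
      simp only [ha]
      exact hφ.isFrameCycle fun v v' hne hv => Frame.sign_last h hf hε hne hv
    have hmem : Memℓp a (ENNReal.ofReal p) := by
      refine memℓp_gen ?_
      rw [hpr, ← e.summable_iff]
      have hnorm : ∀ z : cs.Frame d × C, ‖a (e z)‖ ^ p = |φ z.2| ^ p := by
        intro z
        have h1 : |(z.1.sign f ε : ℝ)| = 1 := by
          have := z.1.abs_sign hf ε
          exact_mod_cast this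
        have h2 : a (e z) = (z.1.sign f ε : ℝ) * φ z.2 := ha z.1 z.2
        rw [h2, norm_mul, Real.norm_eq_abs, Real.norm_eq_abs, h1, one_mul]
      refine Summable.congr ?_ fun z => (hnorm z).symm
      refine (summable_prod_of_nonneg fun _ => Real.rpow_nonneg (abs_nonneg _) _).2
        ⟨fun _ => hB.summable_radial hq hsum c, Summable.of_finite⟩
    refine (Submodule.ne_bot_iff _).2 ⟨⟨a, hmem⟩, hcyc, fun h0 => ?_⟩
    have h1 : a (B.frameSimplex v c) = 0 := congrFun (congrArg Subtype.val h0) _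
    rw [ha, mul_eq_zero] at h1
    rcases h1 with h1 | h1
    · have h2 := v.abs_sign hf ε
      have h3 : v.sign f ε = 0 := by exact_mod_cast h1
      rw [h3] at h2
      simp at h2
    · exact B.radial_self hq c h1

end Building

end

theorem theorem3p4 {S W C : Type*} [Fintype S] [Group W] [Infinite W] [Nonempty C]
    {M : CoxeterMatrix S} (cs : CoxeterSystem M W) (hPM : cs.IsTypePM)
    (B : Building cs C) (q : S → ℕ) (hq : ∀ s, 2 ≤ q s) (hB : B.IsRegular q)
    (n : ℕ) (hn : (Building.davisRealization hB.finiteThickness).HasDim n) :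
    sInf (ENNReal.ofReal '' {p : ℝ | ∃ hp : 1 < p, haveI := fact_one_le_ofReal hp
      Nontrivial ((Building.davisRealization hB.finiteThickness).LpHomology
        (ENNReal.ofReal p) n)}) = 1 + cs.growthRate q ∧
    sSup (ENNReal.ofReal '' {p : ℝ | ∃ hp : 1 < p, haveI := fact_one_le_ofReal hp
      Nontrivial ((Building.davisRealization hB.finiteThickness).ReducedLpCohomology
        (ENNReal.ofReal p) n)}) = 1 + (cs.growthRate q)⁻¹ := by
  obtain ⟨d, h, hor, hgal⟩ := hPM
  obtain rfl := Building.eq_of_hasDim hB.finiteThickness h.1 hn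
  have hempty : IsEmpty ((Building.davisRealization hB.finiteThickness).simplex (d + 2)) :=
    Building.isEmpty_davisSimplex h.1
  obtain ⟨N, hN⟩ := hB.exists_card_cofaces_le h
  set e := cs.growthRate q with he
  have he_top : e ≠ ⊤ := cs.growthRate_ne_top hq
  let A : ℝ → Prop := fun t => Summable fun w : W => (cs.weight q w : ℝ) ^ (-t)
  have hA1 : ∀ t, 0 < t → A t → e ≤ ENNReal.ofReal t := fun t ht h => cs.growthRate_le hq ht h
  have hA2 : ∀ t, e < ENNReal.ofReal t → A t := fun t ht => cs.summable_weight_rpow hq ht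
  have hofReal : ∀ p : ℝ, 1 < p → ENNReal.ofReal p = 1 + ENNReal.ofReal (p - 1) := fun p hp => by
    rw [← ENNReal.ofReal_one, ← ENNReal.ofReal_add zero_le_one (by linarith)]
    congr 1
    ring
  constructor
  · have hset : {p : ℝ | ∃ hp : 1 < p, haveI := fact_one_le_ofReal hp
        Nontrivial ((Building.davisRealization hB.finiteThickness).LpHomology
          (ENNReal.ofReal p) (d + 1))} = {p | 1 < p ∧ A (p - 1)} := by
      have key : ∀ p (hp : 1 < p), haveI := fact_one_le_ofReal hp
          Nontrivial ((Building.davisRealization hB.finiteThickness).LpHomology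
          (ENNReal.ofReal p) (d + 1)) ↔ A (p - 1) := by
        intro p hp
        have := fact_one_le_ofReal hp
        rw [OrderedComplex.nontrivial_lpHomology_iff, hB.lpCycles_ne_bot_iff hq h hor hgal hp]
      ext p
      exact ⟨fun ⟨hp, hp'⟩ => ⟨hp, (key p hp).1 hp'⟩, fun ⟨hp, hp'⟩ => ⟨hp, (key p hp).2 hp'⟩⟩
    rw [hset]
    refine le_antisymm ?_ (le_sInf ?_)
    · refine le_of_forall_gt_imp_ge_of_dense fun b hb => ?_
      obtain ⟨p, hp0, h1, h2⟩ := ENNReal.lt_iff_exists_real_btwn.1 hb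
      have hp : 1 < p := ENNReal.one_lt_ofReal.1 (le_self_add.trans_lt h1)
      rw [hofReal p hp, ENNReal.add_lt_add_iff_left ENNReal.one_ne_top] at h1
      have hmem : p ∈ {p | 1 < p ∧ A (p - 1)} := ⟨hp, hA2 _ h1⟩
      exact (sInf_le (Set.mem_image_of_mem _ hmem)).trans h2.le
    · rintro _ ⟨p, ⟨hp, hp'⟩, rfl⟩
      rw [hofReal p hp]
      exact add_le_add_right (hA1 _ (by linarith) hp') 1
  · have hset : {p : ℝ | ∃ hp : 1 < p, haveI := fact_one_le_ofReal hp
        Nontrivial ((Building.davisRealization hB.finiteThickness).ReducedLpCohomology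
          (ENNReal.ofReal p) (d + 1))} = {p | 1 < p ∧ A (p - 1)⁻¹} := by
      have key : ∀ p (hp : 1 < p), haveI := fact_one_le_ofReal hp
          Nontrivial ((Building.davisRealization hB.finiteThickness).ReducedLpCohomology
          (ENNReal.ofReal p) (d + 1)) ↔ A (p - 1)⁻¹ := by
        intro p hp
        have := fact_one_le_ofReal hp
        have hpq := Real.HolderConjugate.conjExponent hp
        have := fact_one_le_ofReal hpq.symm.lt
        have hpq' : (ENNReal.ofReal p).toReal.HolderConjugate
            (ENNReal.ofReal p.conjExponent).toReal := by
          rwa [ENNReal.toReal_ofReal hpq.pos.le, ENNReal.toReal_ofReal hpq.symm.pos.le]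
        rw [OrderedComplex.nontrivial_reducedLpCohomology_iff,
          OrderedComplex.topologicalClosure_lpCoboundaries_ne_top_iff _ hpq' hN,
          hB.lpCycles_ne_bot_iff hq h hor hgal hpq.symm.lt]
        have : p.conjExponent - 1 = (p - 1)⁻¹ := by
          have : p - 1 ≠ 0 := by linarith
          rw [Real.conjExponent]
          field_simp
          ring
        rw [this]
      ext p
      exact ⟨fun ⟨hp, hp'⟩ => ⟨hp, (key p hp).1 hp'⟩, fun ⟨hp, hp'⟩ => ⟨hp, (key p hp).2 hp'⟩⟩
    rw [hset]
    refine le_antisymm (sSup_le ?_) ?_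
    · rintro _ ⟨p, ⟨hp, hp'⟩, rfl⟩
      have hp1 : 0 < p - 1 := by linarith
      rw [hofReal p hp]
      refine add_le_add_right ?_ 1
      have h1 := hA1 _ (inv_pos.2 hp1) hp'
      rw [ENNReal.ofReal_inv_of_pos hp1] at h1
      exact ENNReal.le_inv_iff_le_inv.1 h1
    · refine le_of_forall_lt_imp_le_of_dense fun b hb => ?_
      have h1 : max b 1 < 1 + e⁻¹ := max_lt hb
        (ENNReal.lt_add_right ENNReal.one_ne_top (ENNReal.inv_ne_zero.2 he_top))
      obtain ⟨p, hp0, h2, h3⟩ := ENNReal.lt_iff_exists_real_btwn.1 h1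
      have hp : 1 < p := ENNReal.one_lt_ofReal.1 ((le_max_right b 1).trans_lt h2)
      rw [hofReal p hp, ENNReal.add_lt_add_iff_left ENNReal.one_ne_top,
        ENNReal.lt_inv_iff_lt_inv, ← ENNReal.ofReal_inv_of_pos (by linarith)] at h3
      have hmem : p ∈ {p | 1 < p ∧ A (p - 1)⁻¹} := ⟨hp, hA2 _ h3⟩
      exact ((le_max_left b 1).trans h2.le).trans (le_sSup (Set.mem_image_of_mem _ hmem))
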